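/- Let $B^n$ be the closed unit ball of $\mathbb{R}^n$, let $X^n=\operatorname{conv}\{\pm e_1,\dots,\pm e_n\}$ be the regular cross-polytope, and let $r_n=1/\sqrt n$ be its inradius. A function $f:[0,\infty)\to[0,\infty)$ is a Blichfeldt gauge for $B^n$ if it is Lebesgue measurable, $I_n(f):=\int_{\mathbb{R}^n}f(|x|)\,dx<\infty$, and for every sequence of isometries $\varphi_1,\varphi_2,\dots$ of $\mathbb{R}^n$ such that the sets $\varphi_iB^n$ have pairwise disjoint interiors one has $\sum_i f(|\varphi_i^{-1}x|)\le 1$ for all $x\in\mathbb{R}^n$. For $0<\varrho\le r_n$ put $X^n_{-\varrho}=\{x\in X^n:\ x+\varrho B^n\subseteq X^n\}$ and $$G(\varrho)=G_{n,f}(\varrho)=\int_{\mathbb{R}^n} f\!\left(\frac{d(x,X^n_{-\varrho})}{\varrho}\right)dx .$$ Let $\delta(X^n)$ denote the packing density of $X^n$, that is, the supremum of the upper densities of all packings of $\mathbb{R}^n$ by congruent copies of $X^n$. (a) For every $r_0>0$ there is an $N$ such that for all $n\ge N$ and every Blichfeldt gauge $f$ for $B^n$ with $f(r)=0$ for all $r>r_0$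 and $I_n(f)\neq 0$ the following hold. The integral $G(\varrho)$ converges and is positive for every $\varrho\in(0,r_n]$; $G$ is the restriction to $(0,r_n]$ of a (unique) real polynomial, and the derivative of this polynomial satisfies $G'(r_n)<0$. Moreover $\delta(X^n)\le \operatorname{vol}(X^n)/G(\varrho)$ for every $\varrho\in(0,r_n]$, and there is a $\varrho\in(0,r_n)$ with $$\frac{\operatorname{vol}(X^n)}{G(\varrho)}<\frac{\operatorname{vol}(X^n)}{r_n^n\operatorname{vol}(B^n)}\cdot\frac{\operatorname{vol}(B^n)}{I_n(f)},$$ so this bound on $\delta(X^n)$ is strictly better than the insphere volume-ratio bound combined with the Blichfeldt bound $\delta(B^n)\le \operatorname{vol}(B^n)/I_n(f)$ from the same gauge. (b) Let $f_0(r)=1-r^2/2$ for $0\le r\le\sqrt2$ and $f_0(r)=0$ for $r>\sqrt2$, and let $f^*(r)=f_0(r)$ for $r\ge1$ and $f^*(r)=1-f_0(2-r)$ for $0\le r\le 1$. For all sufficiently large $n$, $G=G_{n,f^*}$ is the restriction to $(0,r_n]$ of a polynomial, again denoted by $G$, with $G'(r_n)<0$ and $G>0$ on $[0,r_n]$; the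 minimum of $\operatorname{vol}(X^n)/G(\varrho)$ over $[0,r_n]$ is attained at a point of $(0,r_n)$, and at neither endpoint. -/

import Mathlib

open MeasureTheory Set Filter
open scoped ENNReal

noncomputable section

/-- Euclidean `n`-space. -/
abbrev Euc (n : ℕ) : Type := EuclideanSpace ℝ (Fin n)

/-- The closed unit ball `B^n`. -/
def unitBall (n : ℕ) : Set (Euc n) := Metric.closedBall 0 1

/-- The regular cross-polytope `X^n = conv {±e_1, …, ±e_n}`. -/
def crossPolytope (n : ℕ) : Set (Euc n) :=
  convexHull ℝ (⋃ i : Fin n, {EuclideanSpace.single i (1 : ℝ), -EuclideanSpace.single i (1 : ℝ)})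

/-- The inradius `r_n = 1 / √n` of `X^n`. -/
def crossInradius (n : ℕ) : ℝ := 1 / Real.sqrt n

/-- The congruent copies `φ 0 K, φ 1 K, …` of `K` are non-overlapping. -/
def IsPacking {n : ℕ} (K : Set (Euc n)) (φ : ℕ → (Euc n ≃ᵢ Euc n)) : Prop :=
  Pairwise fun i j => Disjoint (interior (φ i '' K)) (interior (φ j '' K))

/-- The (upper) density of the family `φ 0 K, φ 1 K, …`: the limit superior, as `R → ∞`, of the
proportion of the ball of radius `R` about the origin that the family covers. -/
def upperDensity {n : ℕ} (K : Set (Euc n)) (φ : ℕ → (Euc n ≃ᵢ Euc n)) : ℝ≥0∞ :=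
  limsup (fun R : ℝ =>
    volume ((⋃ i, φ i '' K) ∩ Metric.closedBall (0 : Euc n) R) /
      volume (Metric.closedBall (0 : Euc n) R)) atTop

/-- The packing density `δ(K)`: the supremum of the densities of all packings with congruent copies
of `K`. -/
def packingDensity {n : ℕ} (K : Set (Euc n)) : ℝ≥0∞ :=
  ⨆ (φ : ℕ → (Euc n ≃ᵢ Euc n)) (_ : IsPacking K φ), upperDensity K φ

/-- `I_n(f) = ∫_{ℝ^n} f(|x|) dx`. -/
def radialIntegral (n : ℕ) (f : ℝ → ℝ) : ℝ := ∫ x : Euc n, f ‖x‖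

/-- `f` is a Blichfeldt gauge for `K ⊆ ℝ^n`. Only the values of `f` on `[0, ∞)` matter. -/
structure IsBlichfeldtGauge {n : ℕ} (K : Set (Euc n)) (f : ℝ → ℝ) : Prop where
  nonneg : ∀ r : ℝ, 0 ≤ r → 0 ≤ f r
  /-- `f` is Lebesgue measurable on `[0, ∞)`. -/
  measurable : AEMeasurable f (volume.restrict (Ici 0))
  /-- `I_n(f) < ∞`. -/
  integrable : Integrable (fun x : Euc n => f ‖x‖)
  /-- The sum of the transported gauges over a packing is at most one at every point. -/
  sum_le_one : ∀ φ : ℕ → (Euc n ≃ᵢ Euc n), IsPacking K φ →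
    ∀ x : Euc n, ∑' i, ENNReal.ofReal (f ‖(φ i).symm x‖) ≤ 1

/-- The inner parallel domain `K_{-ϱ} = {x ∈ K : ϱ B^n + x ⊆ K}`. -/
def innerParallel {n : ℕ} (K : Set (Euc n)) (ϱ : ℝ) : Set (Euc n) :=
  {x | x ∈ K ∧ Metric.closedBall x ϱ ⊆ K}

/-- The function `g_ϱ(x) = f(d(x, K_{-ϱ}) / ϱ)`, for `0 < ϱ ≤ r(K)`. -/
def transferredGauge {n : ℕ} (K : Set (Euc n)) (f : ℝ → ℝ) (ϱ : ℝ) (x : Euc n) : ℝ :=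
  f (Metric.infDist x (innerParallel K ϱ) / ϱ)

/-- `G(ϱ) = ∫_{ℝ^n} g_ϱ(x) dx` for the cross-polytope `K = X^n`, `0 < ϱ ≤ r_n`. -/
def crossG (n : ℕ) (f : ℝ → ℝ) (ϱ : ℝ) : ℝ :=
  ∫ x, transferredGauge (crossPolytope n) f ϱ x

/-- The polynomial `p` extends `G`. Such a `p` is unique when `0 < n`, because `(0, r_n]` is
infinite; derivatives of `G` at `r_n`, and the value of `G` at `0`, are those of `p`. -/
def ExtendsCrossG (n : ℕ) (f : ℝ → ℝ) (p : Polynomial ℝ) : Prop :=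
  ∀ ϱ ∈ Ioc 0 (crossInradius n), p.eval ϱ = crossG n f ϱ

/-- Blichfeldt's gauge `f_0`. -/
def blichfeldtZero (r : ℝ) : ℝ := if r ≤ Real.sqrt 2 then 1 - r ^ 2 / 2 else 0

/-- Blichfeldt's improved gauge `f*`. -/
def blichfeldtStar (r : ℝ) : ℝ :=
  if 1 ≤ r then blichfeldtZero r else 1 - blichfeldtZero (2 - r)

end

/-!
Put `K = X^n`, the unit ball of the `ℓ¹` norm. Its facets are all at distance `r_n` from the
origin, so the inner parallel body `K_{-ϱ}` is the dilate `t K` with `t = 1 - √n ϱ`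
(`innerParallel_crossPolytope`), and everything depends on the distribution of `d(x, t K)`.

*Polynomiality.* The points outside `t K` are sorted by the face, given by a sign vector `σ`, that
contains their nearest point; this nearest point is a soft thresholding of `x`. The points that
belong to a face of dimension `j` form, up to translation, a product of `t` times the face and a
normal cone, so the affine map that scales by `t` along the face and by `s` along the normal cone
shows that those within distance `s` of `t K` have volume proportional to `t ^ j * s ^ (n - j)`.
This is Steiner's formula `volume_infDist_le`, with non-negative coefficients `steinerCoeff n j`.
It determines the image of Lebesgue measure under `d(·, t K)` (`map_infDist_l1Ball`), and
integrating `f (· / ϱ)` against that image makes `G` a polynomial, `crossPoly n f`, in `ϱ`.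

*Sign of `G'(r_n)`.* At `ϱ = r_n` one has `t = 0`, and only the faces of dimension `0` and `1`
contribute to the derivative: it is negative as soon as the coefficient of order one in `t`
exceeds `√n` times that of order zero. The ratio of these coefficients is the ratio of
`steinerCoeff n 1` and `steinerCoeff n 0` times a ratio of consecutive moments of `f`, and the
latter is at least `1 / r₀` if `f` vanishes beyond `r₀`. What remains does not involve `f`, so it
may be estimated with the Gaussian in place of `f`: since
`d(x, t K) ^ 2 ≤ ‖x‖ ^ 2 - 2 t max |x i| + t ^ 2`, the coefficient of order one is then at least
the Gaussian integral of `max |x i|`, and in high dimension most of the Gaussian mass lies where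
this maximum exceeds any given bound (`exists_lt_steinerCoeff_one`).

*Density bound.* For a packing by copies of `K`, the balls of radius `ϱ` about the points of the
inner parallel bodies nearest to `x` form a packing, so the transferred gauges sum to at most one
(`sum_transferredGauge_le_one`). Integrating over a large ball counts the bodies that meet it
(`packingDensity_le_of_sum_le_one`). As `G(r_n) = r_n ^ n * I_n(f)`, the comparison with the
insphere bound is the inequality `G(ϱ) > G(r_n)` for some `ϱ < r_n`, which follows from
`G'(r_n) < 0`.

*The gauge `f*`.* The minimum is not attained at `r_n` because `G'(r_n) < 0`. It is not attained
at `0` because `G(0) = vol K < G(r_n)`: as `f* ≥ 1 / 10` on `[0, √1.8]`, it suffices that the ball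
of radius `√1.8 * r_n` has much more volume than `K`, which is a matter of Gamma function
estimates and the inequality `0.9 π > e` (`exists_volume_crossPolytope_lt`).
-/

open MeasureTheory Set Filter
open scoped ENNReal Pointwise

/-! ### Balls of the `ℓ¹` norm -/

/-- The dilate `t · X^n` of the cross-polytope, described as a ball of the `ℓ¹` norm. -/
def l1Ball (n : ℕ) (t : ℝ) : Set (Euc n) := {x | ∑ i, |x i| ≤ t}

theorem convex_l1Ball (n : ℕ) (t : ℝ) : Convex ℝ (l1Ball n t) := by
  intro x hx y hy a b ha hb hab
  simp only [l1Ball, mem_ofPred_eq, PiLp.add_apply, PiLp.smul_apply, smul_eq_mul] at *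
  calc ∑ i, |a * x i + b * y i| ≤ ∑ i, (a * |x i| + b * |y i|) := by
        refine Finset.sum_le_sum fun i _ => (abs_add_le _ _).trans ?_
        rw [abs_mul, abs_mul, abs_of_nonneg ha, abs_of_nonneg hb]
    _ = a * ∑ i, |x i| + b * ∑ i, |y i| := by
        rw [Finset.sum_add_distrib, Finset.mul_sum, Finset.mul_sum]
    _ ≤ a * t + b * t := by gcongr
    _ = t := by rw [← add_mul, hab, one_mul]

theorem continuous_sum_abs (n : ℕ) : Continuous fun x : Euc n => ∑ i, |x i| := by fun_prop

theorem isClosed_l1Ball (n : ℕ) (t : ℝ) : IsClosed (l1Ball n t) :=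
  isClosed_le (continuous_sum_abs n) continuous_const

theorem measurableSet_l1Ball (n : ℕ) (t : ℝ) : MeasurableSet (l1Ball n t) :=
  (isClosed_l1Ball n t).measurableSet

theorem norm_le_sum_abs {n : ℕ} (x : Euc n) : ‖x‖ ≤ ∑ i, |x i| := by
  rw [EuclideanSpace.norm_eq]
  refine Real.sqrt_le_iff.2 ⟨Finset.sum_nonneg fun i _ => abs_nonneg _, ?_⟩
  exact Finset.sum_sq_le_sq_sum_of_nonneg fun i _ => abs_nonneg _

theorem sum_abs_le_sqrt_mul_norm {n : ℕ} (x : Euc n) : ∑ i, |x i| ≤ Real.sqrt n * ‖x‖ := by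
  rw [EuclideanSpace.norm_eq, ← Real.sqrt_mul (Nat.cast_nonneg n)]
  refine Real.le_sqrt_of_sq_le ?_
  simpa using sq_sum_le_card_mul_sum_sq (s := Finset.univ) (f := fun i => |x i|)

theorem l1Ball_subset_closedBall (n : ℕ) (t : ℝ) : l1Ball n t ⊆ Metric.closedBall 0 t := by
  intro x hx
  rw [mem_closedBall_zero_iff]
  exact (norm_le_sum_abs x).trans hx

theorem isCompact_l1Ball (n : ℕ) (t : ℝ) : IsCompact (l1Ball n t) :=
  (isCompact_closedBall (0 : Euc n) t).of_isClosed_subset (isClosed_l1Ball n t)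
    (l1Ball_subset_closedBall n t)

theorem zero_mem_l1Ball {n : ℕ} {t : ℝ} (ht : 0 ≤ t) : (0 : Euc n) ∈ l1Ball n t := by
  simpa [l1Ball] using ht

theorem nonempty_l1Ball {n : ℕ} {t : ℝ} (ht : 0 ≤ t) : (l1Ball n t).Nonempty :=
  ⟨0, zero_mem_l1Ball ht⟩

theorem l1Ball_zero (n : ℕ) : l1Ball n 0 = {0} := by
  refine Subset.antisymm ?_ (by simpa using zero_mem_l1Ball le_rfl)
  simpa using l1Ball_subset_closedBall n 0

theorem l1Ball_mul (n : ℕ) {c : ℝ} (hc : 0 < c) (t : ℝ) : l1Ball n (c * t) = c • l1Ball n t := by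
  ext x
  rw [mem_smul_set_iff_inv_smul_mem₀ hc.ne']
  simp only [l1Ball, mem_ofPred_eq, PiLp.smul_apply, smul_eq_mul, abs_mul, abs_inv,
    abs_of_pos hc, ← Finset.mul_sum]
  rw [inv_mul_le_iff₀ hc]

theorem crossPolytope_eq_l1Ball {n : ℕ} (hn : 0 < n) : crossPolytope n = l1Ball n 1 := by
  refine Subset.antisymm (convexHull_min ?_ (convex_l1Ball n 1)) fun x hx => ?_
  · refine iUnion_subset fun i => ?_
    rintro x (rfl | rfl) <;> simp [l1Ball, apply_ite abs]
  · have hC : Convex ℝ (crossPolytope n) := convex_convexHull ℝ _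
    have hseg : ∀ (i : Fin n) (c : ℝ), |c| ≤ 1 →
        c • EuclideanSpace.single i (1 : ℝ) ∈ crossPolytope n := by
      intro i c hc
      have h1 : EuclideanSpace.single i (1 : ℝ) ∈ crossPolytope n :=
        subset_convexHull ℝ _ (mem_iUnion.2 ⟨i, by simp⟩)
      have h2 : -EuclideanSpace.single i (1 : ℝ) ∈ crossPolytope n :=
        subset_convexHull ℝ _ (mem_iUnion.2 ⟨i, by simp⟩)
      have := hC h1 h2 (a := (1 + c) / 2) (b := (1 - c) / 2) (by linarith [abs_le.1 hc])
        (by linarith [abs_le.1 hc]) (by ring)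
      convert this using 1
      module
    have hx' : ∑ i, |x i| ≤ 1 := hx
    have hn' : (0 : ℝ) < n := by exact_mod_cast hn
    -- The slack `1 - ∑ |x i|` is spread evenly over the coordinates, so that the weights sum to 1.
    set w : Fin n → ℝ := fun i => |x i| + (1 - ∑ i, |x i|) / n with hw
    have hwx : ∀ i, |x i| ≤ w i := fun i => by
      have : 0 ≤ (1 - ∑ i, |x i|) / n := div_nonneg (by linarith) hn'.le
      simp only [hw]; linarith
    have hxe : x = ∑ i, w i • ((x i / w i) • EuclideanSpace.single i (1 : ℝ)) := by
      ext j
      have hj : w j * (x j / w j) = x j := by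
        by_cases h0 : w j = 0
        · have : |x j| = 0 := le_antisymm (h0 ▸ hwx j) (abs_nonneg _)
          simp [abs_eq_zero.1 this]
        · field_simp
      simp [Pi.single_apply, hj]
    rw [hxe]
    refine hC.sum_mem (fun i _ => (abs_nonneg _).trans (hwx i)) ?_ fun i _ => hseg i _ ?_
    · simp only [hw, Finset.sum_add_distrib, Finset.sum_const, Finset.card_univ, Fintype.card_fin,
        nsmul_eq_mul]
      field_simp
      ring
    · rw [abs_div, abs_of_nonneg ((abs_nonneg _).trans (hwx i))]
      exact div_le_one_of_le₀ (hwx i) ((abs_nonneg _).trans (hwx i))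

theorem innerParallel_crossPolytope {n : ℕ} (hn : 0 < n) {ϱ : ℝ} (hϱ : 0 ≤ ϱ) :
    innerParallel (crossPolytope n) ϱ = l1Ball n (1 - Real.sqrt n * ϱ) := by
  have hs : 0 < Real.sqrt n := Real.sqrt_pos.2 (by exact_mod_cast hn)
  have hss : Real.sqrt n * Real.sqrt n = n := Real.mul_self_sqrt (Nat.cast_nonneg n)
  rw [crossPolytope_eq_l1Ball hn]
  ext x
  constructor
  · rintro ⟨-, hx⟩
    -- The extreme point of the ball `x + ϱB` in the direction of a facet normal.
    let v : Euc n := WithLp.toLp 2 fun i => if 0 ≤ x i then 1 else -1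
    have hv1 : ∀ i, v i ^ 2 = 1 := fun i => by
      simp only [v]; split_ifs <;> norm_num
    have hv2 : ∀ i, ∀ c : ℝ, 0 ≤ c → |x i + c * v i| = |x i| + c := by
      intro i c hc
      simp only [v]
      split_ifs with h
      · rw [abs_of_nonneg h, abs_of_nonneg (by linarith)]; ring
      · rw [abs_of_neg (not_le.1 h), abs_of_neg (by linarith [not_le.1 h])]; ring
    have hvn : ‖v‖ = Real.sqrt n := by
      rw [EuclideanSpace.norm_eq]; simp [hv1]
    have := hx (a := x + (ϱ / Real.sqrt n) • v) (by
      rw [mem_closedBall_iff_norm, add_sub_cancel_left, norm_smul, hvn, Real.norm_eq_abs,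
        abs_of_nonneg (by positivity), div_mul_cancel₀ _ hs.ne'])
    simp only [l1Ball, mem_ofPred_eq, PiLp.add_apply, PiLp.smul_apply, smul_eq_mul] at this ⊢
    simp only [hv2 _ _ (div_nonneg hϱ hs.le), Finset.sum_add_distrib, Finset.sum_const,
      Finset.card_univ, Fintype.card_fin, nsmul_eq_mul] at this
    have h2 : (n : ℝ) * (ϱ / Real.sqrt n) = Real.sqrt n * ϱ := by
      field_simp; linear_combination -(ϱ * hss)
    linarith
  · intro hx
    have hx' : ∑ i, |x i| ≤ 1 - Real.sqrt n * ϱ := hx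
    have hsub : Metric.closedBall x ϱ ⊆ l1Ball n 1 := by
      intro y hy
      have h1 : ∑ i, |y i| ≤ ∑ i, |x i| + ∑ i, |(y - x) i| := by
        rw [← Finset.sum_add_distrib]
        refine Finset.sum_le_sum fun i _ => ?_
        have := abs_add_le (x i) (y i - x i)
        simpa using this
      have h2 := sum_abs_le_sqrt_mul_norm (y - x)
      have h3 : Real.sqrt n * ‖y - x‖ ≤ Real.sqrt n * ϱ :=
        mul_le_mul_of_nonneg_left (mem_closedBall_iff_norm.1 hy) hs.le
      show ∑ i, |y i| ≤ 1
      linarith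
    exact ⟨hsub (Metric.mem_closedBall_self hϱ), hsub⟩

theorem volume_l1Ball {n : ℕ} {t : ℝ} (ht : 0 < t) :
    volume.real (l1Ball n t) = t ^ n * volume.real (l1Ball n 1) := by
  rw [← mul_one t, l1Ball_mul n ht, mul_one, measureReal_def, Measure.addHaar_smul]
  simp [abs_of_pos ht, measureReal_def, ENNReal.toReal_mul, ht.le]

theorem volume_l1Ball_one_pos (n : ℕ) : 0 < volume.real (l1Ball n 1) := by
  refine ENNReal.toReal_pos (ne_of_gt ?_) (isCompact_l1Ball n 1).measure_ne_top
  refine lt_of_lt_of_le ?_ (measure_mono (s := {x : Euc n | ∑ i, |x i| < 1}) fun x hx => ?_)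
  · refine IsOpen.measure_pos _ (isOpen_lt (continuous_sum_abs n) continuous_const) ⟨0, ?_⟩
    simp
  · exact (show ∑ i, |x i| < 1 from hx).le

theorem volume_l1Ball_one_le {n : ℕ} (hn : 0 < n) :
    volume.real (l1Ball n 1) ≤ 2 ^ n / n.factorial := by
  have : Nonempty (Fin n) := ⟨⟨0, hn⟩⟩
  have h := volume_sum_rpow_le (Fin n) (p := 1) le_rfl 1
  have h2 : volume (l1Ball n 1) =
      volume {x : Fin n → ℝ | (∑ i, |x i| ^ (1 : ℝ)) ^ (1 / (1 : ℝ)) ≤ 1} := by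
    rw [← (PiLp.volume_preserving_toLp (Fin n)).measure_preimage
      (measurableSet_l1Ball n 1).nullMeasurableSet]
    congr 1
    ext x
    simp [l1Ball]
  rw [measureReal_def, h2, h]
  simp only [ENNReal.ofReal_one, one_pow, one_mul, div_one, Fintype.card_fin]
  rw [ENNReal.toReal_ofReal (by positivity), Real.Gamma_nat_eq_factorial]
  norm_num

/-! ### Nearest points of the cross-polytope and its normal cones -/

/-- The number of non-zero entries of a sign vector; the face of the cross-polytope that it
describes has dimension `signCard σ - 1`. -/
def signCard {n : ℕ} (σ : Fin n → SignType) : ℕ := (Finset.univ.filter fun i => σ i ≠ 0).card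

/-- The amount by which the coordinates of `x` in the support of `σ` have to be shrunk to land on
the hyperplane `∑ σ i * y i = t`. -/
noncomputable def threshold {n : ℕ} (σ : Fin n → SignType) (t : ℝ) (x : Euc n) : ℝ :=
  (∑ i, (σ i : ℝ) * x i - t) / signCard σ

/-- The set of the points outside `l1Ball n t` whose nearest point lies in the relative interior of
the face with sign vector `σ`. -/
def faceRegion {n : ℕ} (σ : Fin n → SignType) (t : ℝ) : Set (Euc n) :=
  {x | 0 < threshold σ t x ∧ ∀ i, (σ i ≠ 0 → threshold σ t x < (σ i : ℝ) * x i) ∧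
    (σ i = 0 → |x i| ≤ threshold σ t x)}

/-- The orthogonal projection of `x` to the affine hull of the face of `l1Ball n t` with sign
vector `σ`. -/
noncomputable def faceProj {n : ℕ} (σ : Fin n → SignType) (t : ℝ) (x : Euc n) : Euc n :=
  WithLp.toLp 2 fun i => (σ i : ℝ) ^ 2 * x i - σ i * threshold σ t x

theorem faceProj_apply {n : ℕ} (σ : Fin n → SignType) (t : ℝ) (x : Euc n) (i : Fin n) :
    faceProj σ t x i = (σ i : ℝ) ^ 2 * x i - σ i * threshold σ t x := rfl

theorem SignType.coe_sq_eq_ite (s : SignType) : (s : ℝ) ^ 2 = if s ≠ 0 then 1 else 0 := by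
  cases s <;> simp

theorem sum_sign_sq {n : ℕ} (σ : Fin n → SignType) : ∑ i, (σ i : ℝ) ^ 2 = signCard σ := by
  simp only [SignType.coe_sq_eq_ite, Finset.sum_ite, Finset.sum_const_zero, add_zero, signCard,
    Finset.sum_const, nsmul_eq_mul, mul_one]

theorem signCard_le {n : ℕ} (σ : Fin n → SignType) : signCard σ ≤ n := by
  simpa [signCard] using Finset.card_le_univ (Finset.univ.filter fun i => σ i ≠ 0)

theorem signCard_pos_of_mem_faceRegion {n : ℕ} {σ : Fin n → SignType} {t : ℝ} {x : Euc n}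
    (hx : x ∈ faceRegion σ t) : 0 < signCard σ := by
  by_contra h
  have h0 : signCard σ = 0 := by omega
  have := hx.1
  simp [threshold, h0] at this

theorem measurableSet_faceRegion {n : ℕ} (σ : Fin n → SignType) (t : ℝ) :
    MeasurableSet (faceRegion σ t) := by
  have hm : Measurable (threshold σ t) := by
    unfold threshold
    fun_prop
  have hx : ∀ i, Measurable fun x : Euc n => x i := fun i => by fun_prop
  have he : faceRegion σ t = {x | 0 < threshold σ t x} ∩
      ⋂ i, {x | (σ i ≠ 0 → threshold σ t x < (σ i : ℝ) * x i) ∧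
        (σ i = 0 → |x i| ≤ threshold σ t x)} := by
    ext x
    simp [faceRegion]
  rw [he]
  refine (measurableSet_lt measurable_const hm).inter (MeasurableSet.iInter fun i => ?_)
  by_cases h : σ i = 0
  · simpa [h] using measurableSet_le (hx i).abs hm
  · simpa [h] using measurableSet_lt hm ((hx i).const_mul _)

section
variable {n : ℕ} {σ : Fin n → SignType} {t : ℝ} {x : Euc n}

theorem signCard_mul_threshold (hσ : 0 < signCard σ) :
    signCard σ * threshold σ t x = ∑ i, (σ i : ℝ) * x i - t := by
  have : (0 : ℝ) < signCard σ := by exact_mod_cast hσ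
  unfold threshold
  field_simp

theorem abs_faceProj_apply (hx : x ∈ faceRegion σ t) (i : Fin n) :
    |faceProj σ t x i| = σ i * faceProj σ t x i := by
  have h := (hx.2 i).1
  rw [faceProj_apply]
  rcases hs : σ i with _ | _ | _ <;> simp [hs] at h ⊢
  · rw [abs_of_neg (by linarith)]
    ring
  · linarith

theorem sum_sign_mul_faceProj (hσ : 0 < signCard σ) :
    ∑ i, (σ i : ℝ) * faceProj σ t x i = t := by
  have h : ∀ i, (σ i : ℝ) * faceProj σ t x i = σ i * x i - (σ i : ℝ) ^ 2 * threshold σ t x := by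
    intro i
    rw [faceProj_apply]
    cases σ i <;> simp
    ring
  simp only [h, Finset.sum_sub_distrib, ← Finset.sum_mul, sum_sign_sq,
    signCard_mul_threshold hσ]
  ring

theorem sum_abs_faceProj (hx : x ∈ faceRegion σ t) : ∑ i, |faceProj σ t x i| = t := by
  simp only [abs_faceProj_apply hx, sum_sign_mul_faceProj (signCard_pos_of_mem_faceRegion hx)]

theorem abs_sub_faceProj_le (hx : x ∈ faceRegion σ t) (i : Fin n) :
    |x i - faceProj σ t x i| ≤ threshold σ t x := by
  have h1 := hx.1
  have h := (hx.2 i).2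
  rw [faceProj_apply]
  rcases hs : σ i with _ | _ | _ <;> simp [hs] at h ⊢ <;> try linarith
  · rw [abs_of_pos h1]
  · rw [abs_of_pos h1]

theorem sum_sub_faceProj_mul_faceProj (hx : x ∈ faceRegion σ t) :
    ∑ i, (x i - faceProj σ t x i) * faceProj σ t x i = threshold σ t x * t := by
  rw [← sum_sign_mul_faceProj (t := t) (x := x) (signCard_pos_of_mem_faceRegion hx),
    Finset.mul_sum]
  simp only [sum_sign_mul_faceProj (signCard_pos_of_mem_faceRegion hx)]
  refine Finset.sum_congr rfl fun i _ => ?_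
  rw [faceProj_apply]
  cases σ i <;> simp
  ring

/-- The residual `x - faceProj σ t x` lies in the normal cone at `faceProj σ t x`. -/
theorem inner_sub_faceProj_nonpos (hx : x ∈ faceRegion σ t) {y : Euc n} (hy : y ∈ l1Ball n t) :
    inner ℝ (x - faceProj σ t x) (y - faceProj σ t x) ≤ 0 := by
  have h1 : inner ℝ (x - faceProj σ t x) (faceProj σ t x) = threshold σ t x * t := by
    rw [← sum_sub_faceProj_mul_faceProj hx]
    simp [PiLp.inner_apply, mul_comm]
  have h2 : inner ℝ (x - faceProj σ t x) y ≤ threshold σ t x * t := by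
    calc inner ℝ (x - faceProj σ t x) y = ∑ i, (x i - faceProj σ t x i) * y i := by
          simp [PiLp.inner_apply, mul_comm]
      _ ≤ ∑ i, threshold σ t x * |y i| := by
          refine Finset.sum_le_sum fun i _ => (le_abs_self _).trans ?_
          rw [abs_mul]
          exact mul_le_mul_of_nonneg_right (abs_sub_faceProj_le hx i) (abs_nonneg _)
      _ = threshold σ t x * ∑ i, |y i| := by rw [Finset.mul_sum]
      _ ≤ threshold σ t x * t := mul_le_mul_of_nonneg_left hy hx.1.le
  rw [inner_sub_right]
  linarith

theorem faceProj_mem_l1Ball (hx : x ∈ faceRegion σ t) : faceProj σ t x ∈ l1Ball n t :=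
  (sum_abs_faceProj hx).le

theorem infDist_eq_norm_sub_faceProj (hx : x ∈ faceRegion σ t) :
    Metric.infDist x (l1Ball n t) = ‖x - faceProj σ t x‖ := by
  refine le_antisymm ?_ ?_
  · rw [← dist_eq_norm]
    exact Metric.infDist_le_dist_of_mem (faceProj_mem_l1Ball hx)
  · refine (Metric.le_infDist ⟨_, faceProj_mem_l1Ball hx⟩).2 fun y hy => ?_
    rw [dist_eq_norm]
    refine le_of_sq_le_sq ?_ (norm_nonneg _)
    have h := norm_sub_sq_real (x - faceProj σ t x) (y - faceProj σ t x)
    rw [sub_sub_sub_cancel_right] at h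
    nlinarith [inner_sub_faceProj_nonpos hx hy, sq_nonneg ‖y - faceProj σ t x‖]

theorem notMem_l1Ball_of_mem_faceRegion (hx : x ∈ faceRegion σ t) : x ∉ l1Ball n t := by
  intro h
  have h0 := infDist_eq_norm_sub_faceProj hx
  rw [Metric.infDist_zero_of_mem h, eq_comm, norm_eq_zero, sub_eq_zero] at h0
  have hk := signCard_mul_threshold (t := t) (x := x) (signCard_pos_of_mem_faceRegion hx)
  have h1 : ∑ i, (σ i : ℝ) * x i = t := by
    conv_lhs => rw [h0]
    exact sum_sign_mul_faceProj (signCard_pos_of_mem_faceRegion hx)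
  rw [h1, sub_self] at hk
  have : (0 : ℝ) < signCard σ := by exact_mod_cast signCard_pos_of_mem_faceRegion hx
  exact absurd hk (mul_pos this hx.1).ne'

theorem sign_faceProj_apply (hx : x ∈ faceRegion σ t) (i : Fin n) :
    SignType.sign (faceProj σ t x i) = σ i := by
  have h := (hx.2 i).1
  rw [faceProj_apply]
  rcases hs : σ i with _ | _ | _ <;> simp [hs] at h ⊢
  · exact sign_neg (by linarith)
  · exact sign_pos (by linarith)

theorem disjoint_faceRegion {σ' : Fin n → SignType} (h : σ ≠ σ') :
    Disjoint (faceRegion σ t) (faceRegion σ' t) := by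
  rw [Set.disjoint_left]
  intro x hx hx'
  have h1 := inner_sub_faceProj_nonpos hx (faceProj_mem_l1Ball hx')
  have h2 := inner_sub_faceProj_nonpos hx' (faceProj_mem_l1Ball hx)
  have h3 : inner ℝ (faceProj σ t x - faceProj σ' t x) (faceProj σ t x - faceProj σ' t x) ≤ 0 := by
    have e1 : faceProj σ t x - faceProj σ' t x
      = (x - faceProj σ' t x) - (x - faceProj σ t x) := by abel
    conv_lhs => rw [e1, inner_sub_left]
    rw [← e1]
    rw [← neg_sub (faceProj σ t x) (faceProj σ' t x), inner_neg_right] at h1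
    linarith
  have h4 : faceProj σ t x = faceProj σ' t x := by
    rw [real_inner_self_eq_norm_sq] at h3
    have : ‖faceProj σ t x - faceProj σ' t x‖ = 0 := by
      nlinarith [sq_nonneg ‖faceProj σ t x - faceProj σ' t x‖]
    exact sub_eq_zero.1 (norm_eq_zero.1 this)
  refine h (funext fun i => ?_)
  rw [← sign_faceProj_apply hx i, ← sign_faceProj_apply hx' i, h4]

/-- Soft thresholding: the amount `τ` is found by the intermediate value theorem. -/
theorem exists_mem_faceRegion (ht : 0 < t) (hx : x ∉ l1Ball n t) :
    ∃ σ : Fin n → SignType, x ∈ faceRegion σ t := by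
  have hx' : t < ∑ i, |x i| := not_le.1 hx
  set F : ℝ → ℝ := fun τ => ∑ i, max (|x i| - τ) 0 with hF
  have hc : ContinuousOn F (Icc 0 (∑ i, |x i|)) := by
    apply Continuous.continuousOn
    fun_prop
  have h0 : F 0 = ∑ i, |x i| := by simp [hF]
  have h1 : F (∑ i, |x i|) = 0 := by
    refine Finset.sum_eq_zero fun i _ => max_eq_right ?_
    have := Finset.single_le_sum (f := fun i => |x i|) (fun i _ => abs_nonneg (x i))
      (Finset.mem_univ i)
    simpa using this
  obtain ⟨τ, hτ, hτt⟩ := intermediate_value_Icc' (ht.trans hx').le hc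
    (show t ∈ Icc (F (∑ i, |x i|)) (F 0) from by rw [h0, h1]; exact ⟨ht.le, hx'.le⟩)
  have hτ0 : 0 < τ := by
    refine lt_of_le_of_ne hτ.1 fun h => ?_
    rw [← h, h0] at hτt
    exact hx'.ne' hτt
  let σ : Fin n → SignType := fun i => if τ < |x i| then SignType.sign (x i) else 0
  have hσ0 : ∀ i, σ i ≠ 0 ↔ τ < |x i| := by
    intro i
    simp only [σ]
    split_ifs with h
    · have : x i ≠ 0 := by
        rintro h0
        rw [h0, abs_zero] at h
        linarith
      simp [h, this]
    · simp [h]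
  have hσx : ∀ i, σ i ≠ 0 → (σ i : ℝ) * x i = |x i| := by
    intro i hi
    have h := (hσ0 i).1 hi
    simp only [σ, if_pos h]
    exact sign_mul_self _
  have hterm : ∀ i, max (|x i| - τ) 0 = σ i * x i - (σ i : ℝ) ^ 2 * τ := by
    intro i
    by_cases h : σ i = 0
    · have h' : ¬ τ < |x i| := fun h'' => (hσ0 i).2 h'' h
      rw [h, max_eq_right (by linarith)]
      simp
    · rw [hσx i h, SignType.coe_sq_eq_ite, if_pos h, max_eq_left (by linarith [(hσ0 i).1 h])]
      ring
  have hsum : ∑ i, (σ i : ℝ) * x i - signCard σ * τ = t := by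
    rw [← hτt]
    simp only [hF, hterm, Finset.sum_sub_distrib, ← Finset.sum_mul, sum_sign_sq]
  have hk : 0 < signCard σ := by
    by_contra hk
    have hk0 : signCard σ = 0 := by omega
    have hz : ∀ i, σ i = 0 := by
      intro i
      by_contra hi
      have := Finset.card_eq_zero.1 hk0
      exact absurd (Finset.mem_filter.2 ⟨Finset.mem_univ i, hi⟩) (by rw [this]; simp)
    simp [hz, hk0] at hsum
    exact ht.ne hsum
  have hth : threshold σ t x = τ := by
    have : (0 : ℝ) < signCard σ := by exact_mod_cast hk
    rw [threshold, div_eq_iff this.ne']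
    linarith
  refine ⟨σ, ?_⟩
  refine ⟨by rwa [hth], fun i => ⟨fun h => ?_, fun h => ?_⟩⟩
  · rw [hth, hσx i h]
    exact (hσ0 i).1 h
  · rw [hth]
    exact not_lt.1 fun h'' => (hσ0 i).2 h'' h

end

/-! ### The Steiner polynomial of the cross-polytope -/

section
variable {n : ℕ} (σ : Fin n → SignType) {t s : ℝ}

/-- The affine map that scales by `t` along a face of `l1Ball n 1` and by `s` along its normal
cone. It carries `faceRegion σ 1` to `faceRegion σ t`. -/
noncomputable def faceScale (t s : ℝ) (x : Euc n) : Euc n :=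
  t • faceProj σ 1 x + s • (x - faceProj σ 1 x)

variable {σ}

theorem faceScale_apply (x : Euc n) (i : Fin n) :
    faceScale σ t s x i = t * faceProj σ 1 x i + s * (x i - faceProj σ 1 x i) := by
  simp [faceScale]

theorem threshold_faceScale (hσ : 0 < signCard σ) (x : Euc n) :
    threshold σ t (faceScale σ t s x) = s * threshold σ 1 x := by
  have h1 : ∑ i, (σ i : ℝ) * faceScale σ t s x i
      = t * ∑ i, (σ i : ℝ) * faceProj σ 1 x i
        + s * (∑ i, (σ i : ℝ) * x i - ∑ i, (σ i : ℝ) * faceProj σ 1 x i) := by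
    rw [← Finset.sum_sub_distrib, Finset.mul_sum, Finset.mul_sum, ← Finset.sum_add_distrib]
    refine Finset.sum_congr rfl fun i _ => ?_
    rw [faceScale_apply]
    ring
  rw [threshold, h1, sum_sign_mul_faceProj hσ, threshold]
  ring

theorem faceProj_faceScale (hσ : 0 < signCard σ) (x : Euc n) :
    faceProj σ t (faceScale σ t s x) = t • faceProj σ 1 x := by
  ext i
  rw [faceProj_apply, threshold_faceScale hσ, faceScale_apply, PiLp.smul_apply, smul_eq_mul,
    faceProj_apply]
  cases σ i <;> simp

theorem faceScale_mem_faceRegion_iff (hσ : 0 < signCard σ) (hs : 0 < s) (ht : 0 < t) {x : Euc n} :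
    faceScale σ t s x ∈ faceRegion σ t ↔ x ∈ faceRegion σ 1 := by
  simp only [faceRegion, mem_ofPred_eq, threshold_faceScale hσ]
  refine and_congr (mul_pos_iff_of_pos_left hs) (forall_congr' fun i => and_congr ?_ ?_)
  · refine imp_congr_right fun hi => ?_
    have : (σ i : ℝ) * faceScale σ t s x i
        = t * (σ i * x i - threshold σ 1 x) + s * threshold σ 1 x := by
      rw [faceScale_apply, faceProj_apply]
      rcases h : σ i with _ | _ | _
      · exact absurd h hi
      · simp
        ring
      · simp
    rw [this, lt_add_iff_pos_left, mul_pos_iff_of_pos_left ht, sub_pos]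
  · refine imp_congr_right fun hi => ?_
    have : faceScale σ t s x i = s * x i := by
      rw [faceScale_apply, faceProj_apply, hi]
      simp
    rw [this, abs_mul, abs_of_pos hs, mul_le_mul_iff_right₀ hs]

theorem infDist_faceScale (hs : 0 < s) (ht : 0 < t) {x : Euc n} (hx : x ∈ faceRegion σ 1) :
    Metric.infDist (faceScale σ t s x) (l1Ball n t) = s * Metric.infDist x (l1Ball n 1) := by
  have hσ := signCard_pos_of_mem_faceRegion hx
  rw [infDist_eq_norm_sub_faceProj ((faceScale_mem_faceRegion_iff hσ hs ht).2 hx),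
    infDist_eq_norm_sub_faceProj hx, faceProj_faceScale hσ, faceScale, add_sub_cancel_left,
    norm_smul, Real.norm_eq_abs, abs_of_pos hs]

/-- The linear part of `faceScale` is a diagonal matrix times a rank one perturbation of the
identity. -/
theorem exists_linearMap_faceScale (hσ : 0 < signCard σ) (ht : 0 < t) :
    ∃ (L : Euc n →ₗ[ℝ] Euc n) (b : Euc n),
      LinearMap.det L = t ^ (signCard σ - 1) * s ^ (n + 1 - signCard σ) ∧
      ∀ x, faceScale σ t s x = L x + b := by
  have hk : (0 : ℝ) < signCard σ := by exact_mod_cast hσ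
  let d : Fin n → ℝ := fun i => if σ i ≠ 0 then t else s
  let w : Fin n → ℝ := fun i => σ i * ((s - t) / (signCard σ * t))
  let v : Fin n → ℝ := fun i => σ i
  refine ⟨Matrix.toEuclideanLin (Matrix.diagonal d *
    (1 + Matrix.replicateCol Unit w * Matrix.replicateRow Unit v)),
    WithLp.toLp 2 fun i => σ i * ((t - s) / signCard σ), ?_, fun x => ?_⟩
  · have h1 : v ⬝ᵥ w = (s - t) / t := by
      have : ∀ i, v i * w i = (σ i : ℝ) ^ 2 * ((s - t) / (signCard σ * t)) := fun i => by
        simp only [v, w]; ring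
      simp only [dotProduct, this, ← Finset.sum_mul, sum_sign_sq]
      field_simp
    have h2 : ∏ i, d i = t ^ signCard σ * s ^ (n - signCard σ) := by
      have hc := Finset.card_filter_add_card_filter_not (s := (Finset.univ : Finset (Fin n)))
        (fun i => σ i ≠ 0)
      rw [Finset.card_univ, Fintype.card_fin] at hc
      simp only [d, Finset.prod_ite, Finset.prod_const]
      have hc' : (Finset.univ.filter fun i => ¬σ i ≠ 0).card = n - signCard σ := by
        rw [signCard]
        omega
      rw [hc']
      rfl
    rw [Matrix.toEuclideanLin, Matrix.toLpLin_eq_toLin, LinearMap.det_toLin, Matrix.det_mul,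
      Matrix.det_diagonal,
      Matrix.det_one_add_replicateCol_mul_replicateRow, h1, h2]
    obtain ⟨k, hk'⟩ := Nat.exists_eq_succ_of_ne_zero hσ.ne'
    have hle := signCard_le σ
    rw [hk'] at hle ⊢
    rw [show n + 1 - k.succ = (n - k.succ) + 1 by omega, Nat.succ_sub_one, Nat.succ_eq_add_one,
      pow_succ t, pow_succ s]
    field_simp
    ring
  · ext i
    have hth : ∑ j, (σ j : ℝ) * x j = signCard σ * threshold σ 1 x + 1 := by
      rw [signCard_mul_threshold hσ]; ring
    have hm : (Matrix.diagonal d * (1 + Matrix.replicateCol Unit w *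
        Matrix.replicateRow Unit v)).mulVec x i = d i * (x i + w i * ∑ j, (σ j : ℝ) * x j) := by
      rw [← Matrix.mulVec_mulVec, Matrix.mulVec_diagonal, Matrix.add_mulVec, Matrix.one_mulVec,
        ← Matrix.vecMulVec_eq Unit, Matrix.vecMulVec_mulVec]
      simp [dotProduct, v, mul_comm]
    rw [PiLp.add_apply, Matrix.toLpLin_apply]
    simp only [hm]
    rw [hth, faceScale_apply, faceProj_apply]
    simp only [d, w]
    rcases σ i with _ | _ | _
    · simp
    · simp
      field_simp
      ring
    · simp
      field_simp
      ring

theorem volume_faceRegion_inter (hσ : 0 < signCard σ) (hs : 0 < s) (ht : 0 < t) :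
    volume.real (faceRegion σ t ∩ {x | Metric.infDist x (l1Ball n t) ≤ s}) =
      t ^ (signCard σ - 1) * s ^ (n + 1 - signCard σ) *
        volume.real (faceRegion σ 1 ∩ {x | Metric.infDist x (l1Ball n 1) ≤ 1}) := by
  obtain ⟨L, b, hdet, hL⟩ := exists_linearMap_faceScale (s := s) hσ ht
  set A := faceRegion σ t ∩ {x | Metric.infDist x (l1Ball n t) ≤ s}
  have hpre : faceRegion σ 1 ∩ {x | Metric.infDist x (l1Ball n 1) ≤ 1}
      = L ⁻¹' ((fun x => x + b) ⁻¹' A) := by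
    ext x
    simp only [A, mem_preimage, ← hL, mem_inter_iff, faceScale_mem_faceRegion_iff hσ hs ht]
    refine and_congr_right fun hx => ?_
    simp only [mem_ofPred_eq, infDist_faceScale hs ht hx]
    rw [mul_le_iff_le_one_right hs]
  have hpos : 0 < LinearMap.det L := by rw [hdet]; positivity
  rw [hpre, measureReal_def, measureReal_def, Measure.addHaar_preimage_linearMap _ hpos.ne',
    measure_preimage_add_right, ENNReal.toReal_mul, ENNReal.toReal_ofReal (abs_nonneg _),
    abs_inv, abs_of_pos hpos, ← hdet, mul_inv_cancel_left₀ hpos.ne']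

end

theorem infDist_le_subset {n : ℕ} {t : ℝ} (ht : 0 ≤ t) (s : ℝ) :
    {x : Euc n | Metric.infDist x (l1Ball n t) ≤ s} ⊆ Metric.closedBall 0 (t + s) := by
  intro x hx
  obtain ⟨y, hy, hxy⟩ := (isCompact_l1Ball n t).exists_infDist_eq_dist (nonempty_l1Ball ht) x
  have h1 := l1Ball_subset_closedBall n t hy
  have h2 : dist x y ≤ s := hxy ▸ hx
  rw [Metric.mem_closedBall] at h1 ⊢
  linarith [dist_triangle x y 0]

/-- The coefficients of the Steiner polynomial of the cross-polytope. -/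
noncomputable def steinerCoeff (n j : ℕ) : ℝ :=
  if j = n then volume.real (l1Ball n 1) else
    ∑ σ : Fin n → SignType with signCard σ = j + 1,
      volume.real (faceRegion σ 1 ∩ {x | Metric.infDist x (l1Ball n 1) ≤ 1})

theorem steinerCoeff_nonneg (n j : ℕ) : 0 ≤ steinerCoeff n j := by
  unfold steinerCoeff
  split_ifs
  · exact measureReal_nonneg
  · exact Finset.sum_nonneg fun _ _ => measureReal_nonneg

theorem steinerCoeff_self (n : ℕ) : steinerCoeff n n = volume.real (l1Ball n 1) := if_pos rfl

theorem measurableSet_infDist_le {n : ℕ} (t s : ℝ) :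
    MeasurableSet {x : Euc n | Metric.infDist x (l1Ball n t) ≤ s} :=
  measurableSet_le (Metric.continuous_infDist_pt _).measurable measurable_const

theorem volume_infDist_le_of_pos {n : ℕ} {t s : ℝ} (ht : 0 < t) (hs : 0 < s) :
    volume.real {x : Euc n | Metric.infDist x (l1Ball n t) ≤ s} =
      ∑ j ∈ Finset.range (n + 1), steinerCoeff n j * t ^ j * s ^ (n - j) := by
  set D := {x : Euc n | Metric.infDist x (l1Ball n t) ≤ s} with hD
  have hDfin : volume D ≠ ∞ :=
    ((measure_mono (infDist_le_subset ht.le s)).trans_lt measure_closedBall_lt_top).ne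
  have hsplit : D = l1Ball n t ∪ ⋃ σ ∈ (Finset.univ : Finset (Fin n → SignType)),
      (faceRegion σ t ∩ D) := by
    ext x
    simp only [mem_union, mem_iUnion, mem_inter_iff, Finset.mem_univ, exists_const]
    constructor
    · intro hx
      by_cases hxt : x ∈ l1Ball n t
      · exact Or.inl hxt
      · obtain ⟨σ, hσ⟩ := exists_mem_faceRegion ht hxt
        exact Or.inr ⟨σ, hσ, hx⟩
    · rintro (hx | ⟨σ, -, hx⟩)
      · show Metric.infDist x (l1Ball n t) ≤ s
        rw [Metric.infDist_zero_of_mem hx]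
        exact hs.le
      · exact hx
  have hmeas : ∀ σ : Fin n → SignType, MeasurableSet (faceRegion σ t ∩ D) := fun σ =>
    (measurableSet_faceRegion σ t).inter (measurableSet_infDist_le t s)
  have hfin : ∀ σ : Fin n → SignType, volume (faceRegion σ t ∩ D) ≠ ∞ := fun σ =>
    ((measure_mono inter_subset_right).trans_lt hDfin.lt_top).ne
  have hvol : volume.real D = volume.real (l1Ball n t) +
      ∑ σ : Fin n → SignType, volume.real (faceRegion σ t ∩ D) := by
    conv_lhs => rw [hsplit]
    have hdisj : Disjoint (l1Ball n t)
        (⋃ σ ∈ (Finset.univ : Finset (Fin n → SignType)), (faceRegion σ t ∩ D)) := by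
      simp only [Set.disjoint_left, mem_iUnion, not_exists]
      exact fun x hx σ _ hxσ => notMem_l1Ball_of_mem_faceRegion hxσ.1 hx
    have hpair : ((Finset.univ : Finset (Fin n → SignType)) : Set _).PairwiseDisjoint
        fun σ => faceRegion σ t ∩ D := fun σ _ σ' _ h =>
      (disjoint_faceRegion h).mono inter_subset_left inter_subset_left
    rw [measureReal_union hdisj (Finset.univ.measurableSet_biUnion fun σ _ => hmeas σ)
      (isCompact_l1Ball n t).measure_ne_top
      ((measure_mono (iUnion₂_subset fun σ _ => inter_subset_right)).trans_lt hDfin.lt_top).ne,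
      measureReal_biUnion_finset hpair (fun σ _ => hmeas σ) (fun σ _ => hfin σ)]
  rw [hvol, Finset.sum_range_succ, steinerCoeff_self, Nat.sub_self, pow_zero, mul_one,
    volume_l1Ball ht, mul_comm (t ^ n), add_comm]
  congr 1
  have hzero : ∀ σ : Fin n → SignType, signCard σ = 0 → volume.real (faceRegion σ t ∩ D) = 0 := by
    intro σ h
    have : faceRegion σ t = ∅ := by
      refine eq_empty_of_forall_notMem fun x hx => ?_
      have := signCard_pos_of_mem_faceRegion hx
      omega
    simp [this]
  have hfib := Finset.sum_fiberwise_of_maps_to (s := (Finset.univ : Finset (Fin n → SignType)))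
    (t := Finset.range (n + 1)) (g := signCard)
    (fun σ _ => Finset.mem_range.2 (Nat.lt_succ_of_le (signCard_le σ)))
    (fun σ => volume.real (faceRegion σ t ∩ D))
  rw [← hfib, Finset.sum_range_succ', Finset.sum_eq_zero (s := Finset.univ.filter fun σ => _ = 0)
    (fun σ hσ => hzero σ (Finset.mem_filter.1 hσ).2), add_zero]
  refine Finset.sum_congr rfl fun j hj => ?_
  rw [steinerCoeff, if_neg (Finset.mem_range.1 hj).ne, mul_assoc, mul_comm, Finset.mul_sum]
  refine Finset.sum_congr rfl fun σ hσ => ?_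
  have hk : signCard σ = j + 1 := (Finset.mem_filter.1 hσ).2
  rw [volume_faceRegion_inter (by omega) hs ht, hk, Nat.add_sub_cancel, Nat.add_sub_add_right]

theorem volume_closedBall_eq {n : ℕ} {s : ℝ} (hs : 0 ≤ s) :
    volume.real (Metric.closedBall (0 : Euc n) s) = s ^ n * volume.real (unitBall n) := by
  rw [unitBall, measureReal_def, measureReal_def, Measure.addHaar_closedBall _ _ hs,
    Measure.addHaar_closedBall _ _ zero_le_one]
  simp [ENNReal.toReal_mul, hs]

theorem steinerCoeff_zero (n : ℕ) : steinerCoeff n 0 = volume.real (unitBall n) := by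
  have hT : Tendsto (fun t : ℝ => ∑ j ∈ Finset.range (n + 1),
      steinerCoeff n j * t ^ j * 1 ^ (n - j)) (nhdsWithin 0 (Ioi 0)) (nhds (steinerCoeff n 0)) := by
    have hc : Continuous (fun t : ℝ => ∑ j ∈ Finset.range (n + 1),
        steinerCoeff n j * t ^ j * 1 ^ (n - j)) := by fun_prop
    have := (hc.tendsto 0).mono_left (nhdsWithin_le_nhds (s := Ioi 0))
    simpa [Finset.sum_range_succ'] using this
  have hT2 : Tendsto (fun t : ℝ => (t + 1) ^ n * volume.real (unitBall n))
      (nhdsWithin 0 (Ioi 0)) (nhds (volume.real (unitBall n))) := by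
    have hc : Continuous (fun t : ℝ => (t + 1) ^ n * volume.real (unitBall n)) := by fun_prop
    have := (hc.tendsto 0).mono_left (nhdsWithin_le_nhds (s := Ioi 0))
    simpa using this
  refine le_antisymm (le_of_tendsto_of_tendsto hT hT2 ?_) (ge_of_tendsto hT ?_)
  · filter_upwards [self_mem_nhdsWithin] with t ht
    rw [← volume_infDist_le_of_pos ht one_pos, ← volume_closedBall_eq (by linarith [mem_Ioi.1 ht])]
    exact measureReal_mono (infDist_le_subset (le_of_lt ht) 1) measure_closedBall_lt_top.ne
  · filter_upwards [self_mem_nhdsWithin] with t ht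
    rw [← volume_infDist_le_of_pos ht one_pos]
    refine measureReal_mono (fun x hx => ?_)
      ((measure_mono (infDist_le_subset (le_of_lt ht) 1)).trans_lt measure_closedBall_lt_top).ne
    exact (Metric.infDist_le_dist_of_mem (zero_mem_l1Ball (le_of_lt ht))).trans hx

/-- Steiner's formula for the dilates of the cross-polytope, the degenerate dilate included. -/
theorem volume_infDist_le {n : ℕ} {t s : ℝ} (ht : 0 ≤ t) (hs : 0 ≤ s) :
    volume.real {x : Euc n | Metric.infDist x (l1Ball n t) ≤ s} =
      ∑ j ∈ Finset.range (n + 1), steinerCoeff n j * t ^ j * s ^ (n - j) := by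
  rcases ht.eq_or_lt with rfl | ht
  · rw [Finset.sum_range_succ']
    simp only [l1Ball_zero, Metric.infDist_singleton]
    simp [steinerCoeff_zero]
    rw [mul_comm, ← volume_closedBall_eq hs]
    congr 1
    ext x
    simp
  rcases hs.eq_or_lt with rfl | hs
  · have h1 : {x : Euc n | Metric.infDist x (l1Ball n t) ≤ 0} = l1Ball n t := by
      ext x
      rw [(isClosed_l1Ball n t).mem_iff_infDist_zero (nonempty_l1Ball ht.le)]
      exact ⟨fun h => le_antisymm h Metric.infDist_nonneg, fun h => le_of_eq h⟩
    rw [h1, Finset.sum_range_succ, Finset.sum_eq_zero, steinerCoeff_self, volume_l1Ball ht]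
    · simp [mul_comm]
    · intro j hj
      have := Finset.mem_range.1 hj
      rw [zero_pow (by omega), mul_zero]
  · exact volume_infDist_le_of_pos ht hs

/-! ### The distribution of the distance to the cross-polytope -/

/-- The measure `(m + 1) s ^ m ds` on `(0, ∞)`, which gives mass `b ^ (m + 1)` to `(0, b]`. -/
noncomputable def powMeasure (m : ℕ) : Measure ℝ :=
  (volume.restrict (Ioi 0)).withDensity fun s => ENNReal.ofReal ((m + 1) * s ^ m)

theorem powMeasure_Iic (m : ℕ) {b : ℝ} (hb : 0 ≤ b) :
    powMeasure m (Iic b) = ENNReal.ofReal (b ^ (m + 1)) := by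
  rw [powMeasure, withDensity_apply _ measurableSet_Iic,
    Measure.restrict_restrict measurableSet_Iic,
    inter_comm, Ioi_inter_Iic]
  have hi : IntegrableOn (fun s : ℝ => ((m : ℝ) + 1) * s ^ m) (Ioc 0 b) :=
    (by fun_prop : Continuous fun s : ℝ => ((m : ℝ) + 1) * s ^ m).integrableOn_Ioc
  rw [← ofReal_integral_eq_lintegral_ofReal hi, ← intervalIntegral.integral_of_le hb]
  · congr 1
    rw [intervalIntegral.integral_const_mul, integral_pow]
    field_simp
    simp
  · filter_upwards [ae_restrict_mem measurableSet_Ioc] with s hs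
    have := hs.1.le
    positivity

theorem powMeasure_Iic_of_neg (m : ℕ) {b : ℝ} (hb : b < 0) : powMeasure m (Iic b) = 0 := by
  rw [powMeasure, withDensity_apply _ measurableSet_Iic,
    Measure.restrict_restrict measurableSet_Iic,
    inter_comm, Ioi_inter_Iic, Ioc_eq_empty (by linarith)]
  simp

theorem measurable_powDensity (m : ℕ) :
    Measurable fun s : ℝ => ENNReal.ofReal (((m : ℝ) + 1) * s ^ m) := by fun_prop

theorem powDensity_smul_ae (f : ℝ → ℝ) (m : ℕ) :
    (fun s : ℝ => (ENNReal.ofReal (((m : ℝ) + 1) * s ^ m)).toReal • f s)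
      =ᵐ[volume.restrict (Ioi 0)] fun s => ((m : ℝ) + 1) * (f s * s ^ m) := by
  filter_upwards [ae_restrict_mem measurableSet_Ioi] with s hs
  have hs' : 0 ≤ s := le_of_lt hs
  rw [ENNReal.toReal_ofReal (by positivity), smul_eq_mul]
  ring

theorem integrable_powMeasure {f : ℝ → ℝ} {m : ℕ}
    (hf : IntegrableOn (fun s => f s * s ^ m) (Ioi 0)) : Integrable f (powMeasure m) := by
  rw [powMeasure, integrable_withDensity_iff_integrable_smul' (measurable_powDensity m)
    (ae_of_all _ fun _ => ENNReal.ofReal_lt_top)]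
  exact (hf.const_mul _).congr (powDensity_smul_ae f m).symm

theorem integral_powMeasure (f : ℝ → ℝ) (m : ℕ) :
    ∫ s, f s ∂powMeasure m = (m + 1) * ∫ s in Ioi 0, f s * s ^ m := by
  rw [powMeasure, integral_withDensity_eq_integral_toReal_smul (measurable_powDensity m)
    (ae_of_all _ fun _ => ENNReal.ofReal_lt_top), integral_congr_ae (powDensity_smul_ae f m),
    integral_const_mul]

theorem Measure.ext_of_Iic_of_ne_top {μ ν : Measure ℝ} (hμ : ∀ a, μ (Iic a) ≠ ∞)
    (h : ∀ a, μ (Iic a) = ν (Iic a)) : μ = ν := by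
  have : IsLocallyFiniteMeasure μ :=
    ⟨fun x => ⟨Iic (x + 1), Iic_mem_nhds (by linarith), (hμ _).lt_top⟩⟩
  refine Measure.ext_of_Ioc μ ν fun a b hab => ?_
  rw [← Iic_sdiff_Iic, measure_sdiff (Iic_subset_Iic.2 hab.le) measurableSet_Iic.nullMeasurableSet
    (hμ a), measure_sdiff (Iic_subset_Iic.2 hab.le) measurableSet_Iic.nullMeasurableSet
    (h a ▸ hμ a), h, h]

theorem map_infDist_l1Ball {n : ℕ} {t : ℝ} (ht : 0 ≤ t) :
    Measure.map (fun x : Euc n => Metric.infDist x (l1Ball n t)) volume =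
      ENNReal.ofReal (steinerCoeff n n * t ^ n) • Measure.dirac 0 +
        ∑ j ∈ Finset.range n,
          ENNReal.ofReal (steinerCoeff n j * t ^ j) • powMeasure (n - 1 - j) := by
  have hm : Measurable fun x : Euc n => Metric.infDist x (l1Ball n t) :=
    (Metric.continuous_infDist_pt _).measurable
  have hfin : ∀ s, volume {x : Euc n | Metric.infDist x (l1Ball n t) ≤ s} ≠ ∞ := fun s =>
    ((measure_mono (infDist_le_subset ht s)).trans_lt measure_closedBall_lt_top).ne
  have hmap : ∀ s, Measure.map (fun x : Euc n => Metric.infDist x (l1Ball n t)) volume (Iic s)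
      = volume {x : Euc n | Metric.infDist x (l1Ball n t) ≤ s} := fun s =>
    Measure.map_apply hm measurableSet_Iic
  refine Measure.ext_of_Iic_of_ne_top (fun s => by rw [hmap]; exact hfin s) fun s => ?_
  rw [hmap]
  simp only [Measure.add_apply, Measure.smul_apply, Measure.finsetSum_apply, smul_eq_mul]
  rcases lt_or_ge s 0 with hs | hs
  · have he : {x : Euc n | Metric.infDist x (l1Ball n t) ≤ s} = ∅ :=
      eq_empty_of_forall_notMem fun x hx => absurd (hx.trans_lt hs) (not_lt.2 Metric.infDist_nonneg)
    simp [he, powMeasure_Iic_of_neg _ hs, hs]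
  · rw [← ENNReal.ofReal_toReal (hfin s), ← measureReal_def, volume_infDist_le ht hs,
      Finset.sum_range_succ, add_comm, ENNReal.ofReal_add, ENNReal.ofReal_sum_of_nonneg]
    · congr 1
      · simp [hs]
      · refine Finset.sum_congr rfl fun j hj => ?_
        have hj' := Finset.mem_range.1 hj
        rw [powMeasure_Iic _ hs, ← ENNReal.ofReal_mul
          (mul_nonneg (steinerCoeff_nonneg n j) (pow_nonneg ht j)),
          show n - 1 - j + 1 = n - j by omega]
    · intro j _
      have := steinerCoeff_nonneg n j
      positivity
    · have := steinerCoeff_nonneg n n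
      positivity
    · refine Finset.sum_nonneg fun j _ => ?_
      have := steinerCoeff_nonneg n j
      positivity

/-- The moment `∫ f(s) s^m ds` over `(0, ∞)`. -/
noncomputable def halfMoment (f : ℝ → ℝ) (m : ℕ) : ℝ := ∫ s in Ioi 0, f s * s ^ m

/-- The coefficient of `t ^ j * ϱ ^ (n - j)` in `∫ f (d(x, t X^n) / ϱ) dx`. -/
noncomputable def gaugeCoeff (n : ℕ) (f : ℝ → ℝ) (j : ℕ) : ℝ :=
  if j = n then steinerCoeff n n * f 0
  else steinerCoeff n j * ((n - j : ℕ) * halfMoment f (n - 1 - j))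

theorem integral_infDist_l1Ball {n : ℕ} {f : ℝ → ℝ}
    (hf : AEMeasurable f (volume.restrict (Ici 0)))
    (hi : ∀ m < n, IntegrableOn (fun s => f s * s ^ m) (Ioi 0)) {t : ℝ} (ht : 0 ≤ t) :
    Integrable (fun x : Euc n => f (Metric.infDist x (l1Ball n t))) ∧
      ∫ x : Euc n, f (Metric.infDist x (l1Ball n t)) =
        ∑ j ∈ Finset.range (n + 1), gaugeCoeff n f j * t ^ j := by
  have hm : Measurable fun x : Euc n => Metric.infDist x (l1Ball n t) :=
    (Metric.continuous_infDist_pt _).measurable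
  have hac : ENNReal.ofReal (steinerCoeff n n * t ^ n) • Measure.dirac 0 +
        ∑ j ∈ Finset.range n, ENNReal.ofReal (steinerCoeff n j * t ^ j) • powMeasure (n - 1 - j)
      ≪ Measure.dirac 0 + volume.restrict (Ici (0 : ℝ)) := by
    intro A hA
    simp only [Measure.add_apply, add_eq_zero, Measure.smul_apply, Measure.finsetSum_apply,
      smul_eq_mul] at hA ⊢
    refine ⟨by rw [hA.1, mul_zero], Finset.sum_eq_zero fun j _ => ?_⟩
    have h1 : volume.restrict (Ioi (0 : ℝ)) A = 0 :=
      Measure.absolutelyContinuous_of_le (Measure.restrict_mono Ioi_subset_Ici_self le_rfl) hA.2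
    rw [powMeasure, withDensity_absolutelyContinuous _ _ h1, mul_zero]
  have hmeas := ((aemeasurable_dirac (a := (0 : ℝ)) (f := f)).add_measure hf).mono_ac hac
  have hint : ∀ j ∈ Finset.range n,
      Integrable f (ENNReal.ofReal (steinerCoeff n j * t ^ j) • powMeasure (n - 1 - j)) := by
    intro j hj
    have hj' := Finset.mem_range.1 hj
    exact (integrable_powMeasure (hi _ (by omega))).smul_measure ENNReal.ofReal_ne_top
  have hint0 : Integrable f (ENNReal.ofReal (steinerCoeff n n * t ^ n) • Measure.dirac (0 : ℝ)) :=
    (integrable_dirac (by simp)).smul_measure ENNReal.ofReal_ne_top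
  have hintS := integrable_finsetSum_measure.2 hint
  have hmap := map_infDist_l1Ball (n := n) ht
  constructor
  · refine (integrable_map_measure (μ := volume) (f := fun x : Euc n =>
      Metric.infDist x (l1Ball n t)) (g := f) ?_ hm.aemeasurable).1 ?_
    · rw [hmap]
      exact hmeas.aestronglyMeasurable
    · rw [hmap]
      exact hint0.add_measure hintS
  · rw [← integral_map (μ := volume) (φ := fun x : Euc n => Metric.infDist x (l1Ball n t))
      hm.aemeasurable (by rw [hmap]; exact hmeas.aestronglyMeasurable), hmap,
      integral_add_measure hint0 hintS, integral_finsetSum_measure hint, Finset.sum_range_succ,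
      add_comm]
    congr 1
    · refine Finset.sum_congr rfl fun j hj => ?_
      have hj' := Finset.mem_range.1 hj
      rw [integral_smul_measure, ENNReal.toReal_ofReal
        (mul_nonneg (steinerCoeff_nonneg n j) (pow_nonneg ht j)), integral_powMeasure, gaugeCoeff,
        if_neg hj'.ne, halfMoment, smul_eq_mul, ← Nat.cast_succ,
        show (n - 1 - j).succ = n - j by omega]
      ring
    · rw [integral_smul_measure, ENNReal.toReal_ofReal
        (mul_nonneg (steinerCoeff_nonneg n n) (pow_nonneg ht n)), integral_dirac, gaugeCoeff,
        if_pos rfl, smul_eq_mul]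
      ring

theorem integral_infDist_div_l1Ball {n : ℕ} {f : ℝ → ℝ}
    (hf : AEMeasurable f (volume.restrict (Ici 0)))
    (hi : ∀ m < n, IntegrableOn (fun s => f s * s ^ m) (Ioi 0)) {t ϱ : ℝ} (ht : 0 ≤ t)
    (hϱ : 0 < ϱ) :
    Integrable (fun x : Euc n => f (Metric.infDist x (l1Ball n t) / ϱ)) ∧
      ∫ x : Euc n, f (Metric.infDist x (l1Ball n t) / ϱ) =
        ∑ j ∈ Finset.range (n + 1), gaugeCoeff n f j * (t ^ j * ϱ ^ (n - j)) := by
  have hscale : (fun x : Euc n => f (Metric.infDist x (l1Ball n t) / ϱ))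
      = fun x => f (Metric.infDist (ϱ⁻¹ • x) (l1Ball n (t / ϱ))) := by
    ext x
    rw [div_eq_inv_mul t, l1Ball_mul n (inv_pos.2 hϱ), infDist_smul₀ (inv_pos.2 hϱ).ne',
      Real.norm_eq_abs, abs_of_pos (inv_pos.2 hϱ), div_eq_inv_mul]
  obtain ⟨h1, h2⟩ := integral_infDist_l1Ball hf hi (div_nonneg ht hϱ.le)
  rw [hscale]
  refine ⟨(integrable_comp_smul_iff volume
    (fun x : Euc n => f (Metric.infDist x (l1Ball n (t / ϱ)))) (inv_pos.2 hϱ).ne').2 h1, ?_⟩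
  rw [Measure.integral_comp_inv_smul_of_nonneg volume
    (fun x : Euc n => f (Metric.infDist x (l1Ball n (t / ϱ)))) hϱ.le, h2, finrank_euclideanSpace,
    Fintype.card_fin, smul_eq_mul, Finset.mul_sum]
  refine Finset.sum_congr rfl fun j hj => ?_
  have hj' : j ≤ n := Nat.lt_succ_iff.1 (Finset.mem_range.1 hj)
  obtain ⟨k, rfl⟩ := Nat.exists_eq_add_of_le hj'
  rw [Nat.add_sub_cancel_left, div_pow, pow_add]
  field_simp

/-! ### The extension of `G` to a polynomial -/

/-- The polynomial in `ϱ` that agrees with `crossG n f` on `(0, r_n]`. -/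
noncomputable def crossPoly (n : ℕ) (f : ℝ → ℝ) : Polynomial ℝ :=
  ∑ j ∈ Finset.range (n + 1), Polynomial.C (gaugeCoeff n f j) *
    ((1 - Polynomial.C (Real.sqrt n) * Polynomial.X) ^ j * Polynomial.X ^ (n - j))

theorem eval_crossPoly (n : ℕ) (f : ℝ → ℝ) (ϱ : ℝ) :
    (crossPoly n f).eval ϱ =
      ∑ j ∈ Finset.range (n + 1), gaugeCoeff n f j * ((1 - Real.sqrt n * ϱ) ^ j * ϱ ^ (n - j)) := by
  simp [crossPoly, Polynomial.eval_finsetSum]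

theorem sqrt_mul_crossInradius {n : ℕ} (hn : 0 < n) : Real.sqrt n * crossInradius n = 1 := by
  have : Real.sqrt n ≠ 0 := (Real.sqrt_pos.2 (by exact_mod_cast hn)).ne'
  rw [crossInradius]
  field_simp

theorem crossInradius_pos {n : ℕ} (hn : 0 < n) : 0 < crossInradius n :=
  one_div_pos.2 (Real.sqrt_pos.2 (by exact_mod_cast hn))

theorem one_sub_sqrt_mul_nonneg {n : ℕ} (hn : 0 < n) {ϱ : ℝ} (hϱ : ϱ ≤ crossInradius n) :
    0 ≤ 1 - Real.sqrt n * ϱ := by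
  have := mul_le_mul_of_nonneg_left hϱ (Real.sqrt_nonneg n)
  rw [sqrt_mul_crossInradius hn] at this
  linarith

theorem transferredGauge_crossPolytope {n : ℕ} (hn : 0 < n) (f : ℝ → ℝ) {ϱ : ℝ} (hϱ : 0 ≤ ϱ) :
    transferredGauge (crossPolytope n) f ϱ =
      fun x => f (Metric.infDist x (l1Ball n (1 - Real.sqrt n * ϱ)) / ϱ) := by
  ext x
  rw [transferredGauge, innerParallel_crossPolytope hn hϱ]

section
variable {n : ℕ} {f : ℝ → ℝ}

theorem integrable_transferredGauge (hn : 0 < n) (hf : AEMeasurable f (volume.restrict (Ici 0)))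
    (hi : ∀ m < n, IntegrableOn (fun s => f s * s ^ m) (Ioi 0)) {ϱ : ℝ}
    (hϱ : ϱ ∈ Ioc 0 (crossInradius n)) :
    Integrable (transferredGauge (crossPolytope n) f ϱ) := by
  rw [transferredGauge_crossPolytope hn f hϱ.1.le]
  exact (integral_infDist_div_l1Ball hf hi (one_sub_sqrt_mul_nonneg hn hϱ.2) hϱ.1).1

theorem extendsCrossG_crossPoly (hn : 0 < n) (hf : AEMeasurable f (volume.restrict (Ici 0)))
    (hi : ∀ m < n, IntegrableOn (fun s => f s * s ^ m) (Ioi 0)) :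
    ExtendsCrossG n f (crossPoly n f) := by
  intro ϱ hϱ
  rw [crossG, transferredGauge_crossPolytope hn f hϱ.1.le, eval_crossPoly,
    (integral_infDist_div_l1Ball hf hi (one_sub_sqrt_mul_nonneg hn hϱ.2) hϱ.1).2]

theorem gaugeCoeff_zero_eq_radialIntegral (hf : AEMeasurable f (volume.restrict (Ici 0)))
    (hi : ∀ m < n, IntegrableOn (fun s => f s * s ^ m) (Ioi 0)) :
    gaugeCoeff n f 0 = radialIntegral n f := by
  have h := (integral_infDist_l1Ball (n := n) hf hi le_rfl).2
  simpa [l1Ball_zero, Finset.sum_range_succ', radialIntegral] using h.symm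

theorem eval_crossPoly_crossInradius (hn : 0 < n)
    (hf : AEMeasurable f (volume.restrict (Ici 0)))
    (hi : ∀ m < n, IntegrableOn (fun s => f s * s ^ m) (Ioi 0)) :
    (crossPoly n f).eval (crossInradius n) = crossInradius n ^ n * radialIntegral n f := by
  rw [eval_crossPoly, sqrt_mul_crossInradius hn, sub_self, Finset.sum_range_succ',
    ← gaugeCoeff_zero_eq_radialIntegral hf hi]
  simp [mul_comm]

theorem eval_zero_crossPoly (n : ℕ) (f : ℝ → ℝ) :
    (crossPoly n f).eval 0 = volume.real (l1Ball n 1) * f 0 := by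
  rw [eval_crossPoly, Finset.sum_range_succ, Finset.sum_eq_zero]
  · simp [gaugeCoeff, steinerCoeff_self]
  · intro j hj
    have := Finset.mem_range.1 hj
    rw [zero_pow (by omega), mul_zero, mul_zero]

theorem halfMoment_nonneg (hf0 : ∀ s, 0 ≤ s → 0 ≤ f s) (m : ℕ) : 0 ≤ halfMoment f m :=
  setIntegral_nonneg measurableSet_Ioi fun s hs =>
    mul_nonneg (hf0 s (le_of_lt hs)) (pow_nonneg (le_of_lt hs) m)

theorem gaugeCoeff_nonneg (hf0 : ∀ s, 0 ≤ s → 0 ≤ f s) (j : ℕ) : 0 ≤ gaugeCoeff n f j := by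
  unfold gaugeCoeff
  split_ifs
  · exact mul_nonneg (steinerCoeff_nonneg n n) (hf0 0 le_rfl)
  · exact mul_nonneg (steinerCoeff_nonneg n j)
      (mul_nonneg (Nat.cast_nonneg _) (halfMoment_nonneg hf0 _))

theorem gaugeCoeff_mul_nonneg (hn : 0 < n) (hf0 : ∀ s, 0 ≤ s → 0 ≤ f s) {ϱ : ℝ}
    (hϱ : ϱ ∈ Icc 0 (crossInradius n)) (j : ℕ) :
    0 ≤ gaugeCoeff n f j * ((1 - Real.sqrt n * ϱ) ^ j * ϱ ^ (n - j)) :=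
  mul_nonneg (gaugeCoeff_nonneg hf0 j) (mul_nonneg
    (pow_nonneg (one_sub_sqrt_mul_nonneg hn hϱ.2) j) (pow_nonneg hϱ.1 _))

theorem pow_mul_radialIntegral_le_eval_crossPoly (hn : 0 < n)
    (hf : AEMeasurable f (volume.restrict (Ici 0)))
    (hi : ∀ m < n, IntegrableOn (fun s => f s * s ^ m) (Ioi 0))
    (hf0 : ∀ s, 0 ≤ s → 0 ≤ f s) {ϱ : ℝ} (hϱ : ϱ ∈ Icc 0 (crossInradius n)) :
    ϱ ^ n * radialIntegral n f ≤ (crossPoly n f).eval ϱ := by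
  have h := Finset.single_le_sum (fun j _ => gaugeCoeff_mul_nonneg hn hf0 hϱ j)
    (Finset.mem_range.2 n.succ_pos)
  rw [eval_crossPoly, ← gaugeCoeff_zero_eq_radialIntegral hf hi]
  simpa [mul_comm] using h

theorem derivative_crossPoly_crossInradius (hn : 2 ≤ n) :
    (crossPoly n f).derivative.eval (crossInradius n) =
      crossInradius n ^ (n - 1) * (n * gaugeCoeff n f 0 - Real.sqrt n * gaugeCoeff n f 1) := by
  obtain ⟨m, rfl⟩ := Nat.exists_eq_add_of_le' hn
  have hr := sqrt_mul_crossInradius (n := m + 2) (by omega)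
  have h0 : 1 - Real.sqrt ((m : ℝ) + 2) * crossInradius (m + 2) = 0 := by
    rw [← hr]; push_cast; ring
  simp only [crossPoly, Polynomial.derivative_sum, Polynomial.eval_finsetSum]
  rw [Finset.sum_range_succ', Finset.sum_range_succ', Finset.sum_eq_zero]
  · simp [Polynomial.derivative_mul, h0]
    ring
  · intro j _
    simp [Polynomial.derivative_mul, Polynomial.derivative_pow, h0]

end

/-! ### Gaussian comparison -/

/-- The density `exp (-s ^ 2 / 2)` of the Gaussian distribution, not normalized. -/
noncomputable def gaussDensity (s : ℝ) : ℝ := Real.exp (-s ^ 2 / 2)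

theorem continuous_gaussDensity : Continuous gaussDensity := by
  unfold gaussDensity
  fun_prop

theorem gaussDensity_pos (s : ℝ) : 0 < gaussDensity s := Real.exp_pos _

theorem gaussDensity_mul_pow_eqOn (m : ℕ) :
    EqOn (fun s => gaussDensity s * s ^ m)
      (fun s : ℝ => s ^ (m : ℝ) * Real.exp (-(1 / 2) * s ^ (2 : ℝ))) (Ioi 0) := by
  intro s _
  simp only [gaussDensity, Real.rpow_natCast, Real.rpow_two]
  rw [mul_comm]
  ring_nf

theorem integrableOn_gaussDensity_mul_pow (m : ℕ) :
    IntegrableOn (fun s => gaussDensity s * s ^ m) (Ioi 0) := by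
  rw [integrableOn_congr_fun (gaussDensity_mul_pow_eqOn m) measurableSet_Ioi]
  exact integrableOn_rpow_mul_exp_neg_mul_rpow (by linarith [m.cast_nonneg (α := ℝ)]) two_pos
    (by norm_num)

theorem halfMoment_gaussDensity (m : ℕ) :
    halfMoment gaussDensity m =
      (1 / 2 : ℝ) ^ (-((m : ℝ) + 1) / 2) * (1 / 2) * Real.Gamma (((m : ℝ) + 1) / 2) := by
  rw [halfMoment, setIntegral_congr_fun measurableSet_Ioi (gaussDensity_mul_pow_eqOn m)]
  exact integral_rpow_mul_exp_neg_mul_rpow two_pos (by linarith [m.cast_nonneg (α := ℝ)])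
    (by norm_num)

theorem halfMoment_gaussDensity_pos (m : ℕ) : 0 < halfMoment gaussDensity m := by
  rw [halfMoment_gaussDensity]
  have := Real.Gamma_pos_of_pos (s := ((m : ℝ) + 1) / 2) (by positivity)
  positivity

theorem halfMoment_gaussDensity_add_two (m : ℕ) :
    halfMoment gaussDensity (m + 2) = (m + 1) * halfMoment gaussDensity m := by
  rw [halfMoment_gaussDensity, halfMoment_gaussDensity]
  have h1 : ((m + 2 : ℕ) + 1 : ℝ) / 2 = ((m : ℝ) + 1) / 2 + 1 := by push_cast; ring
  have h2 : -((m + 2 : ℕ) + 1 : ℝ) / 2 = -((m : ℝ) + 1) / 2 - 1 := by push_cast; ring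
  rw [h1, h2, Real.Gamma_add_one (by positivity), Real.rpow_sub_one (by norm_num)]
  ring

/-- Log-convexity of the moments, from `2 √(m + 1) s ≤ s ^ 2 + (m + 1)`. -/
theorem sqrt_mul_halfMoment_gaussDensity_le (m : ℕ) :
    Real.sqrt (m + 1) * halfMoment gaussDensity (m + 1) ≤ halfMoment gaussDensity (m + 2) := by
  have hint : ∀ k, IntegrableOn (fun s => gaussDensity s * s ^ k) (Ioi 0) :=
    integrableOn_gaussDensity_mul_pow
  have h : ∫ s in Ioi 0, 2 * Real.sqrt (m + 1) * (gaussDensity s * s ^ (m + 1)) ≤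
      ∫ s in Ioi 0, (gaussDensity s * s ^ (m + 2) + (m + 1) * (gaussDensity s * s ^ m)) := by
    refine setIntegral_mono_on ((hint _).const_mul _) ((hint _).add ((hint _).const_mul _))
      measurableSet_Ioi fun s hs => ?_
    have h1 : 0 ≤ gaussDensity s * s ^ m * (s - Real.sqrt (m + 1)) ^ 2 :=
      mul_nonneg (mul_nonneg (gaussDensity_pos s).le (pow_nonneg (le_of_lt hs) m)) (sq_nonneg _)
    have h2 : Real.sqrt ((m : ℝ) + 1) ^ 2 = m + 1 := Real.sq_sqrt (by positivity)
    have h3 : gaussDensity s * s ^ m * (s - Real.sqrt (m + 1)) ^ 2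
      = gaussDensity s * s ^ (m + 2) + Real.sqrt (m + 1) ^ 2 * (gaussDensity s * s ^ m)
        - 2 * Real.sqrt (m + 1) * (gaussDensity s * s ^ (m + 1)) := by ring
    rw [h3, h2] at h1
    linarith
  rw [integral_const_mul, integral_add (hint _) ((hint _).const_mul _), integral_const_mul] at h
  have h4 := halfMoment_gaussDensity_add_two m
  simp only [halfMoment] at h4 ⊢
  linarith

theorem gaussDensity_norm_eq_prod {n : ℕ} (x : Euc n) :
    gaussDensity ‖x‖ = ∏ i, gaussDensity (x i) := by
  simp only [gaussDensity]
  rw [← Real.exp_sum, EuclideanSpace.real_norm_sq_eq, ← Finset.sum_div, Finset.sum_neg_distrib]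

theorem integral_prod_eq_pow (n : ℕ) (h : ℝ → ℝ) :
    ∫ x : Euc n, ∏ i, h (x i) = (∫ s, h s) ^ n := by
  have := (EuclideanSpace.volume_preserving_symm_measurableEquiv_toLp (Fin n)).integral_comp'
    (fun x : Fin n → ℝ => ∏ i, h (x i))
  rw [integral_fintype_prod_volume_eq_pow, Fintype.card_fin] at this
  exact this

theorem infDist_l1Ball_sq_le {n : ℕ} {t : ℝ} (ht : 0 ≤ t) (x : Euc n) (i : Fin n) :
    Metric.infDist x (l1Ball n t) ^ 2 ≤ ‖x‖ ^ 2 - 2 * t * |x i| + t ^ 2 := by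
  let c : ℝ := if 0 ≤ x i then t else -t
  have hc : |c| = t := by simp only [c]; split_ifs <;> simp [ht]
  have hcx : c * x i = t * |x i| := by
    simp only [c]
    split_ifs with h
    · rw [abs_of_nonneg h]
    · rw [abs_of_neg (not_le.1 h)]; ring
  have hmem : EuclideanSpace.single i c ∈ l1Ball n t := by
    simp [l1Ball, apply_ite abs, hc]
  have h1 := Metric.infDist_le_dist_of_mem (x := x) hmem
  have h2 := norm_sub_sq_real x (EuclideanSpace.single i c)
  have h3 : inner ℝ x (EuclideanSpace.single i c) = c * x i := by
    simp [EuclideanSpace.inner_single_right]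
  have h4 : ‖EuclideanSpace.single i c‖ = t := by simp [hc]
  rw [dist_eq_norm] at h1
  rw [h3, hcx, h4] at h2
  calc Metric.infDist x (l1Ball n t) ^ 2 ≤ ‖x - EuclideanSpace.single i c‖ ^ 2 :=
        pow_le_pow_left₀ Metric.infDist_nonneg h1 2
    _ = _ := by rw [h2]; ring

/-- The part of space where the maximum norm is at least `M`. -/
def farSet (n : ℕ) (M : ℝ) : Set (Euc n) := {x | ∃ i, M ≤ |x i|}

theorem measurableSet_farSet (n : ℕ) (M : ℝ) : MeasurableSet (farSet n M) := by
  have : farSet n M = ⋃ i, {x | M ≤ |x i|} := by ext x; simp [farSet]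
  rw [this]
  refine MeasurableSet.iUnion fun i => measurableSet_le measurable_const ?_
  fun_prop

theorem integrable_gaussDensity_norm (n : ℕ) : Integrable fun x : Euc n => gaussDensity ‖x‖ := by
  have h := (integral_infDist_l1Ball (n := n) continuous_gaussDensity.aemeasurable
    (fun m _ => integrableOn_gaussDensity_mul_pow m) le_rfl).1
  simpa [l1Ball_zero] using h

theorem gaussDensity_infDist_ge {n : ℕ} {t M : ℝ} (ht : 0 ≤ t) (hM : 0 ≤ M) (x : Euc n) :
    (1 - t ^ 2 / 2) * (gaussDensity ‖x‖ +
      t * M * (farSet n M).indicator (fun x => gaussDensity ‖x‖) x) ≤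
      gaussDensity (Metric.infDist x (l1Ball n t)) := by
  have hg := gaussDensity_pos ‖x‖
  have h1 : 1 - t ^ 2 / 2 ≤ Real.exp (-(t ^ 2 / 2)) := by
    linarith [Real.add_one_le_exp (-(t ^ 2 / 2))]
  have h1' : Real.exp (-(t ^ 2 / 2)) ≤ 1 := Real.exp_le_one_iff.2 (by nlinarith [sq_nonneg t])
  by_cases hx : x ∈ farSet n M
  · obtain ⟨i, hi⟩ := id hx
    rw [indicator_of_mem hx]
    have h2 : gaussDensity ‖x‖ * (Real.exp (t * M) * Real.exp (-(t ^ 2 / 2))) ≤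
        gaussDensity (Metric.infDist x (l1Ball n t)) := by
      simp only [gaussDensity]
      rw [← Real.exp_add, ← Real.exp_add, Real.exp_le_exp]
      have := infDist_l1Ball_sq_le ht x i
      nlinarith [mul_le_mul_of_nonneg_left hi ht]
    have h3 : (1 - t ^ 2 / 2) * (1 + t * M) ≤ Real.exp (t * M) * Real.exp (-(t ^ 2 / 2)) := by
      have h4 : 1 + t * M ≤ Real.exp (t * M) := by linarith [Real.add_one_le_exp (t * M)]
      have h5 : 0 ≤ 1 + t * M := by positivity
      calc (1 - t ^ 2 / 2) * (1 + t * M) ≤ Real.exp (-(t ^ 2 / 2)) * (1 + t * M) :=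
            mul_le_mul_of_nonneg_right h1 h5
        _ ≤ Real.exp (-(t ^ 2 / 2)) * Real.exp (t * M) :=
            mul_le_mul_of_nonneg_left h4 (Real.exp_pos _).le
        _ = _ := mul_comm _ _
    calc _ = gaussDensity ‖x‖ * ((1 - t ^ 2 / 2) * (1 + t * M)) := by ring
      _ ≤ _ := (mul_le_mul_of_nonneg_left h3 hg.le).trans h2
  · rw [indicator_of_notMem hx, mul_zero, add_zero]
    have h2 : gaussDensity ‖x‖ ≤ gaussDensity (Metric.infDist x (l1Ball n t)) := by
      simp only [gaussDensity, Real.exp_le_exp]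
      have h5 := Metric.infDist_le_dist_of_mem (x := x) (zero_mem_l1Ball (n := n) ht)
      rw [dist_zero_right] at h5
      have := pow_le_pow_left₀ Metric.infDist_nonneg h5 2
      linarith
    nlinarith

/-- Comparison of the terms of first order in `t` in the lower bound for
`∫ gaussDensity (d(x, t X^n)) dx`. -/
theorem mul_setIntegral_farSet_le_gaugeCoeff {n : ℕ} (hn : 0 < n) {M : ℝ} (hM : 0 ≤ M) :
    M * ∫ x in farSet n M, gaussDensity ‖x‖ ≤ gaugeCoeff n gaussDensity 1 := by
  have hint := integrable_gaussDensity_norm n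
  have hmom : ∀ m < n, IntegrableOn (fun s => gaussDensity s * s ^ m) (Ioi 0) :=
    fun m _ => integrableOn_gaussDensity_mul_pow m
  have hG := continuous_gaussDensity.aemeasurable (μ := volume.restrict (Ici (0 : ℝ)))
  set Z := ∫ x : Euc n, gaussDensity ‖x‖ with hZ
  set Y := ∫ x in farSet n M, gaussDensity ‖x‖ with hY
  have h0 : gaugeCoeff n gaussDensity 0 = Z := gaugeCoeff_zero_eq_radialIntegral hG hmom
  have hind : Integrable ((farSet n M).indicator fun x : Euc n => gaussDensity ‖x‖) :=
    hint.indicator (measurableSet_farSet n M)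
  obtain ⟨k, rfl⟩ := Nat.exists_eq_succ_of_ne_zero hn.ne'
  have key : ∀ t : ℝ, 0 < t → M * Y - t / 2 * (Z + t * M * Y) ≤
      ∑ j ∈ Finset.range (k + 1), gaugeCoeff (k + 1) gaussDensity (j + 1) * t ^ j := by
    intro t ht
    obtain ⟨h1, h2⟩ := integral_infDist_l1Ball (n := k + 1) hG hmom ht.le
    have h3 := integral_mono ((hint.add (hind.const_mul (t * M))).const_mul (1 - t ^ 2 / 2)) h1
      (fun x => gaussDensity_infDist_ge ht.le hM x)
    simp only [Pi.add_apply] at h3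
    rw [integral_const_mul, integral_add hint (hind.const_mul _), integral_const_mul,
      integral_indicator (measurableSet_farSet _ M), h2, Finset.sum_range_succ', h0] at h3
    have h4 : ∑ j ∈ Finset.range (k + 1), gaugeCoeff (k + 1) gaussDensity (j + 1) * t ^ (j + 1)
        = t * ∑ j ∈ Finset.range (k + 1), gaugeCoeff (k + 1) gaussDensity (j + 1) * t ^ j := by
      rw [Finset.mul_sum]
      exact Finset.sum_congr rfl fun j _ => by ring
    rw [h4, pow_zero, mul_one] at h3
    refine le_of_mul_le_mul_left ?_ ht
    linear_combination h3
  have hc1 : Continuous fun t : ℝ => M * Y - t / 2 * (Z + t * M * Y) := by fun_prop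
  have hc2 : Continuous fun t : ℝ =>
      ∑ j ∈ Finset.range (k + 1), gaugeCoeff (k + 1) gaussDensity (j + 1) * t ^ j := by fun_prop
  have hl := le_of_tendsto_of_tendsto
    ((hc1.tendsto 0).mono_left (nhdsWithin_le_nhds (s := Ioi 0)))
    ((hc2.tendsto 0).mono_left (nhdsWithin_le_nhds (s := Ioi 0)))
    (by filter_upwards [self_mem_nhdsWithin] with t ht using key t ht)
  simpa [Finset.sum_range_succ'] using hl

theorem setIntegral_farSet_gaussDensity (n : ℕ) (M : ℝ) :
    ∫ x in farSet n M, gaussDensity ‖x‖ =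
      (∫ s, gaussDensity s) ^ n - (∫ s in {s : ℝ | |s| < M}, gaussDensity s) ^ n := by
  have hint := integrable_gaussDensity_norm n
  have h1 := integral_add_compl (measurableSet_farSet n M) hint
  have hms : MeasurableSet {s : ℝ | |s| < M} := measurableSet_lt (by fun_prop) measurable_const
  have h2 : ∫ x : Euc n, gaussDensity ‖x‖ = (∫ s, gaussDensity s) ^ n := by
    simp only [gaussDensity_norm_eq_prod]
    exact integral_prod_eq_pow n gaussDensity
  have h3 : ∫ x in (farSet n M)ᶜ, gaussDensity ‖x‖
      = (∫ s in {s : ℝ | |s| < M}, gaussDensity s) ^ n := by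
    rw [← integral_indicator (measurableSet_farSet n M).compl, ← integral_indicator hms,
      ← integral_prod_eq_pow n]
    congr 1
    ext x
    by_cases hx : x ∈ farSet n M
    · obtain ⟨i, hi⟩ := id hx
      rw [indicator_of_notMem (by simpa using hx), eq_comm]
      refine Finset.prod_eq_zero (Finset.mem_univ i) (indicator_of_notMem ?_ _)
      exact not_lt.2 hi
    · rw [indicator_of_mem hx, gaussDensity_norm_eq_prod]
      refine Finset.prod_congr rfl fun i _ => (indicator_of_mem ?_ _).symm
      exact not_le.1 fun h => hx ⟨i, h⟩
  rw [← h2, ← h3]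
  linarith

theorem integrable_gaussDensity : Integrable gaussDensity := by
  have h := integrable_exp_neg_mul_sq (b := 1 / 2) (by norm_num)
  refine h.congr (ae_of_all _ fun s => ?_)
  simp only [gaussDensity]
  ring_nf

theorem setIntegral_abs_lt_gaussDensity_lt (M : ℝ) :
    ∫ s in {s : ℝ | |s| < M}, gaussDensity s < ∫ s, gaussDensity s := by
  have hms : MeasurableSet {s : ℝ | |s| < M} := measurableSet_lt (by fun_prop) measurable_const
  rw [← integral_add_compl hms integrable_gaussDensity]
  refine lt_add_of_pos_right _ ?_
  rw [setIntegral_pos_iff_support_of_nonneg_ae (ae_of_all _ fun s => (gaussDensity_pos s).le)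
    integrable_gaussDensity.integrableOn]
  have hs : Function.support gaussDensity = univ :=
    eq_univ_of_forall fun s => (gaussDensity_pos s).ne'
  rw [hs, univ_inter]
  refine lt_of_lt_of_le ?_ (measure_mono (s := Ici M) fun s hs => ?_)
  · simp
  · exact not_lt.2 ((mem_Ici.1 hs).trans (le_abs_self s))

/-- In high dimension half of the Gaussian mass lies outside any given cube. -/
theorem exists_half_le_setIntegral_farSet (M : ℝ) :
    ∃ N : ℕ, ∀ n, N ≤ n →
      radialIntegral n gaussDensity / 2 ≤ ∫ x in farSet n M, gaussDensity ‖x‖ := by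
  set c := ∫ s, gaussDensity s with hc
  set z := ∫ s in {s : ℝ | |s| < M}, gaussDensity s with hz
  have hzc : z < c := setIntegral_abs_lt_gaussDensity_lt M
  have hz0 : 0 ≤ z := integral_nonneg fun s => (gaussDensity_pos s).le
  have hc0 : 0 < c := hz0.trans_lt hzc
  obtain ⟨N, hN⟩ := exists_pow_lt_of_lt_one (show (0 : ℝ) < 1 / 2 by norm_num)
    ((div_lt_one hc0).2 hzc)
  refine ⟨N, fun n hn => ?_⟩
  have h1 : (z / c) ^ n ≤ 1 / 2 :=
    (pow_le_pow_of_le_one (div_nonneg hz0 hc0.le) ((div_lt_one hc0).2 hzc).le hn).trans hN.le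
  rw [div_pow, div_le_iff₀ (pow_pos hc0 n)] at h1
  have h2 : radialIntegral n gaussDensity = c ^ n := by
    rw [radialIntegral]
    simp only [gaussDensity_norm_eq_prod]
    exact integral_prod_eq_pow n gaussDensity
  rw [h2, setIntegral_farSet_gaussDensity]
  linarith

/-- The quotient of `steinerCoeff n 1` by `steinerCoeff n 0` is `n / 2` times the mean width of
`X^n`; it grows faster than any constant multiple of `√n`. -/
theorem exists_lt_steinerCoeff_one (C : ℝ) :
    ∃ N : ℕ, 3 ≤ N ∧ ∀ n, N ≤ n →
      C * Real.sqrt n * (steinerCoeff n 0 * n) < steinerCoeff n 1 * (n - 1 : ℕ) := by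
  -- `√(n - 2) ≥ √n / 2`, and half of the Gaussian mass counts, which makes `4` the right factor.
  set M : ℝ := 4 * (|C| + 1) with hM
  have hM0 : 0 ≤ M := by positivity
  obtain ⟨N, hN⟩ := exists_half_le_setIntegral_farSet M
  refine ⟨max N 3, le_max_right _ _, fun n hn => ?_⟩
  have hn3 : 3 ≤ n := (le_max_right _ _).trans hn
  have h1 := mul_setIntegral_farSet_le_gaugeCoeff (n := n) (by omega) hM0
  have h2 := mul_le_mul_of_nonneg_left (hN n ((le_max_left _ _).trans hn)) hM0
  have h0 := gaugeCoeff_zero_eq_radialIntegral (n := n) continuous_gaussDensity.aemeasurable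
    (fun m _ => integrableOn_gaussDensity_mul_pow m)
  rw [← h0] at h2
  have h3 := h2.trans h1
  obtain ⟨m, rfl⟩ := Nat.exists_eq_add_of_le' hn3
  have e0 : gaugeCoeff (m + 3) gaussDensity 0
      = steinerCoeff (m + 3) 0 * ((m + 3 : ℕ) * halfMoment gaussDensity (m + 2)) := by
    simp [gaugeCoeff]
  have e1 : gaugeCoeff (m + 3) gaussDensity 1
      = steinerCoeff (m + 3) 1 * ((m + 3 - 1 : ℕ) * halfMoment gaussDensity (m + 1)) := by
    simp [gaugeCoeff]
  rw [e0, e1] at h3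
  have hJ := halfMoment_gaussDensity_pos (m + 1)
  have h4 := sqrt_mul_halfMoment_gaussDensity_le m
  have h5 : Real.sqrt (m + 3 : ℕ) / 2 ≤ Real.sqrt (m + 1) := by
    rw [div_le_iff₀ two_pos, Real.sqrt_le_left (by positivity), mul_pow,
      Real.sq_sqrt (by positivity)]
    push_cast
    linarith [m.cast_nonneg (α := ℝ)]
  have ha : 0 < steinerCoeff (m + 3) 0 * (m + 3 : ℕ) := by
    refine mul_pos ?_ (by positivity)
    rw [steinerCoeff_zero]
    exact ENNReal.toReal_pos (Metric.measure_closedBall_pos _ _ one_pos).ne'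
      measure_closedBall_lt_top.ne
  have hs : 0 < Real.sqrt (m + 3 : ℕ) := Real.sqrt_pos.2 (by positivity)
  set J := halfMoment gaussDensity (m + 1)
  set A := steinerCoeff (m + 3) 0 * (m + 3 : ℕ)
  refine lt_of_mul_lt_mul_right ?_ hJ.le
  calc C * Real.sqrt (m + 3 : ℕ) * A * J
      < (|C| + 1) * Real.sqrt (m + 3 : ℕ) * A * J := by
        gcongr
        linarith [le_abs_self C]
    _ = M / 2 * A * (Real.sqrt (m + 3 : ℕ) / 2 * J) := by rw [hM]; ring
    _ ≤ M / 2 * A * (Real.sqrt (m + 1) * J) := by gcongr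
    _ ≤ M / 2 * A * halfMoment gaussDensity (m + 2) := by gcongr
    _ ≤ steinerCoeff (m + 3) 1 * (m + 3 - 1 : ℕ) * J := by linear_combination h3

/-! ### Gauges of bounded support -/

section
variable {f : ℝ → ℝ} {r₀ : ℝ}

theorem integrableOn_mul_pow_of_bounded (hf : AEMeasurable f (volume.restrict (Ici 0)))
    (hf0 : ∀ s, 0 ≤ s → 0 ≤ f s) (hf1 : ∀ s, 0 ≤ s → f s ≤ 1) (hr : ∀ s, r₀ < s → f s = 0)
    (m : ℕ) : IntegrableOn (fun s => f s * s ^ m) (Ioi 0) := by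
  have hg : IntegrableOn (fun s : ℝ => (Iic r₀).indicator (fun s => s ^ m) s) (Ioi 0) := by
    rw [IntegrableOn, integrable_indicator_iff measurableSet_Iic, IntegrableOn,
      Measure.restrict_restrict measurableSet_Iic, inter_comm, Ioi_inter_Iic]
    exact (continuous_pow m).integrableOn_Ioc
  have hfm : AEMeasurable f (volume.restrict (Ioi 0)) :=
    hf.mono_measure (Measure.restrict_mono Ioi_subset_Ici_self le_rfl)
  refine hg.mono' (hfm.mul (by fun_prop)).aestronglyMeasurable ?_
  filter_upwards [ae_restrict_mem measurableSet_Ioi] with s hs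
  have hs' : 0 ≤ s := le_of_lt hs
  rw [Real.norm_eq_abs, abs_of_nonneg (mul_nonneg (hf0 s hs') (pow_nonneg hs' m))]
  by_cases h : s ≤ r₀
  · rw [indicator_of_mem (mem_Iic.2 h)]
    exact mul_le_of_le_one_left (pow_nonneg hs' m) (hf1 s hs')
  · rw [hr s (not_le.1 h), zero_mul, indicator_of_notMem (by simpa using h)]

theorem halfMoment_succ_le (hf0 : ∀ s, 0 ≤ s → 0 ≤ f s) (hr : ∀ s, r₀ < s → f s = 0)
    (hi : ∀ m, IntegrableOn (fun s => f s * s ^ m) (Ioi 0)) (m : ℕ) :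
    halfMoment f (m + 1) ≤ r₀ * halfMoment f m := by
  rw [halfMoment, halfMoment, ← integral_const_mul]
  refine setIntegral_mono_on (hi _) ((hi _).const_mul _) measurableSet_Ioi fun s hs => ?_
  have hs' : 0 ≤ s := le_of_lt hs
  by_cases h : s ≤ r₀
  · have : 0 ≤ f s * s ^ m := mul_nonneg (hf0 s hs') (pow_nonneg hs' m)
    calc f s * s ^ (m + 1) = s * (f s * s ^ m) := by ring
      _ ≤ _ := mul_le_mul_of_nonneg_right h this
  · simp [hr s (not_le.1 h)]

/-- The sign of `G'(r_n)`, uniformly for all gauges supported on `[0, r₀]`. -/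
theorem exists_derivative_crossPoly_neg (r₀ : ℝ) :
    ∃ N : ℕ, 3 ≤ N ∧ ∀ n, N ≤ n → ∀ f : ℝ → ℝ, AEMeasurable f (volume.restrict (Ici 0)) →
      (∀ s, 0 ≤ s → 0 ≤ f s) → (∀ s, 0 ≤ s → f s ≤ 1) → (∀ s, r₀ < s → f s = 0) →
      0 < radialIntegral n f → (crossPoly n f).derivative.eval (crossInradius n) < 0 := by
  obtain ⟨N, hN3, hN⟩ := exists_lt_steinerCoeff_one r₀
  refine ⟨N, hN3, fun n hn f hf hf0 hf1 hr hI => ?_⟩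
  have hn3 : 3 ≤ n := hN3.trans hn
  have hi := integrableOn_mul_pow_of_bounded hf hf0 hf1 hr
  rw [derivative_crossPoly_crossInradius (by omega)]
  rw [← gaugeCoeff_zero_eq_radialIntegral hf (fun m _ => hi m)] at hI
  refine mul_neg_of_pos_of_neg (pow_pos (crossInradius_pos (by omega)) _) ?_
  have h1 := hN n hn
  obtain ⟨m, rfl⟩ := Nat.exists_eq_add_of_le' hn3
  have e0 : gaugeCoeff (m + 3) f 0
      = steinerCoeff (m + 3) 0 * ((m + 3 : ℕ) * halfMoment f (m + 2)) := by
    simp [gaugeCoeff]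
  have e1 : gaugeCoeff (m + 3) f 1
      = steinerCoeff (m + 3) 1 * ((m + 3 - 1 : ℕ) * halfMoment f (m + 1)) := by
    simp [gaugeCoeff]
  have h2 := halfMoment_succ_le hf0 hr hi (m + 1)
  have h3 := halfMoment_nonneg hf0 (m + 1)
  have hA0 : 0 ≤ steinerCoeff (m + 3) 0 * (m + 3 : ℕ) :=
    mul_nonneg (steinerCoeff_nonneg _ _) (Nat.cast_nonneg _)
  have h4 : 0 < halfMoment f (m + 1) := by
    refine lt_of_le_of_ne h3 fun h => ?_
    rw [← h, mul_zero] at h2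
    rw [e0, le_antisymm h2 (halfMoment_nonneg hf0 _)] at hI
    simp at hI
  have hs : 0 < Real.sqrt (m + 3 : ℕ) := Real.sqrt_pos.2 (by positivity)
  have hss : Real.sqrt (m + 3 : ℕ) * Real.sqrt (m + 3 : ℕ) = (m + 3 : ℕ) :=
    Real.mul_self_sqrt (Nat.cast_nonneg _)
  have h5 : Real.sqrt (m + 3 : ℕ) * gaugeCoeff (m + 3) f 0 < gaugeCoeff (m + 3) f 1 := by
    calc Real.sqrt (m + 3 : ℕ) * gaugeCoeff (m + 3) f 0
        = Real.sqrt (m + 3 : ℕ) * (steinerCoeff (m + 3) 0 * (m + 3 : ℕ)) *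
            halfMoment f (m + 2) := by
          rw [e0]; ring
      _ ≤ Real.sqrt (m + 3 : ℕ) * (steinerCoeff (m + 3) 0 * (m + 3 : ℕ)) *
            (r₀ * halfMoment f (m + 1)) := by gcongr
      _ = r₀ * Real.sqrt (m + 3 : ℕ) * (steinerCoeff (m + 3) 0 * (m + 3 : ℕ)) *
            halfMoment f (m + 1) := by ring
      _ < steinerCoeff (m + 3) 1 * (m + 3 - 1 : ℕ) * halfMoment f (m + 1) :=
          mul_lt_mul_of_pos_right h1 h4
      _ = _ := by rw [e1]; ring
  have h6 := mul_lt_mul_of_pos_left h5 hs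
  rw [← mul_assoc, hss] at h6
  linarith

end

/-! ### Blichfeldt's density bound -/

section
variable {n : ℕ} {f : ℝ → ℝ}

theorem IsBlichfeldtGauge.le_one (hn : 0 < n) (hf : IsBlichfeldtGauge (unitBall n) f) {r : ℝ}
    (hr : 0 ≤ r) : f r ≤ 1 := by
  -- The sum bound speaks of infinite packings, so the ball is put into a row of translates.
  let e : Euc n := EuclideanSpace.single ⟨0, hn⟩ 1
  have he : ‖e‖ = 1 := by simp [e]
  let φ : ℕ → (Euc n ≃ᵢ Euc n) := fun i => IsometryEquiv.addRight ((3 * i : ℝ) • e)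
  have hφ : IsPacking (unitBall n) φ := by
    intro i j hij
    refine Disjoint.mono interior_subset interior_subset ?_
    rw [Set.disjoint_left]
    rintro _ ⟨x, hx, rfl⟩ ⟨y, hy, hxy⟩
    rw [unitBall, mem_closedBall_zero_iff] at hx hy
    have h1 : x - y = (3 * ((j : ℝ) - i)) • e := by
      simp only [φ, IsometryEquiv.addRight_apply] at hxy
      rw [mul_sub, sub_smul, sub_eq_sub_iff_add_eq_add, ← hxy, add_comm]
    have h2 : ‖x - y‖ = 3 * |(j : ℝ) - i| := by
      rw [h1, norm_smul, he, Real.norm_eq_abs, abs_mul]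
      norm_num
    have h3 : (1 : ℝ) ≤ |(j : ℝ) - i| := by
      have : (j : ℤ) - i ≠ 0 := by omega
      exact_mod_cast Int.one_le_abs this
    linarith [norm_sub_le x y]
  have h := hf.sum_le_one φ hφ (r • e)
  have h0 : (φ 0).symm (r • e) = r • e := by simp [φ]
  have h1 := (ENNReal.le_tsum 0).trans h
  rw [h0, norm_smul, he, mul_one, Real.norm_eq_abs, abs_of_nonneg hr] at h1
  exact ENNReal.ofReal_le_one.1 h1

/-- The transferred gauges of a packing of `K` sum to at most one: with nearest points `p i` of
`x` in the inner parallel bodies, the balls of radius `ϱ` about the `p i` form a packing, to which,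
scaled by `1 / ϱ`, the defining property of the gauge applies. -/
theorem sum_transferredGauge_le_one {K : Set (Euc n)} (hf : IsBlichfeldtGauge (unitBall n) f)
    {ϱ : ℝ} (hϱ : 0 < ϱ) (hc : IsCompact (innerParallel K ϱ)) (hne : (innerParallel K ϱ).Nonempty)
    {φ : ℕ → (Euc n ≃ᵢ Euc n)} (hφ : IsPacking K φ) (x : Euc n) :
    ∑' i, ENNReal.ofReal (transferredGauge K f ϱ ((φ i).symm x)) ≤ 1 := by
  choose p hp hpd using fun i => hc.exists_infDist_eq_dist hne ((φ i).symm x)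
  let ψ : ℕ → (Euc n ≃ᵢ Euc n) := fun i => IsometryEquiv.addRight (ϱ⁻¹ • φ i (p i))
  have hψ : IsPacking (unitBall n) ψ := by
    intro i j hij
    have hdis := hφ hij
    have hmem : ∀ k, ∀ y ∈ interior (ψ k '' unitBall n), ϱ • y ∈ interior (φ k '' K) := by
      intro k y hy
      have hsub : Metric.ball (φ k (p k)) ϱ ⊆ interior (φ k '' K) := by
        refine interior_maximal ?_ Metric.isOpen_ball
        intro z hz
        refine ⟨(φ k).symm z, (hp k).2 ?_, by simp⟩
        rw [Metric.mem_closedBall, ← (φ k).dist_eq, IsometryEquiv.apply_symm_apply]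
        exact (Metric.mem_ball.1 hz).le
      have himg : ψ k '' unitBall n = Metric.closedBall (ϱ⁻¹ • φ k (p k)) 1 := by
        rw [unitBall, IsometryEquiv.image_closedBall]
        simp [ψ]
      rw [himg, interior_closedBall _ one_ne_zero, Metric.mem_ball, dist_eq_norm] at hy
      refine hsub ?_
      rw [Metric.mem_ball, dist_eq_norm]
      have : ϱ • y - φ k (p k) = ϱ • (y - ϱ⁻¹ • φ k (p k)) := by
        rw [smul_sub, smul_inv_smul₀ hϱ.ne']
      rw [this, norm_smul, Real.norm_eq_abs, abs_of_pos hϱ]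
      exact mul_lt_of_lt_one_right hϱ hy
    exact Set.disjoint_left.2 fun y hy hy' =>
      Set.disjoint_left.1 hdis (hmem i y hy) (hmem j y hy')
  refine (le_of_eq (tsum_congr fun i => ?_)).trans (hf.sum_le_one ψ hψ (ϱ⁻¹ • x))
  congr 1
  rw [transferredGauge, hpd]
  congr 1
  have h1 : (ψ i).symm (ϱ⁻¹ • x) = ϱ⁻¹ • (x - φ i (p i)) := by
    simp [ψ, sub_eq_add_neg]
  rw [h1, norm_smul, Real.norm_eq_abs, abs_of_pos (inv_pos.2 hϱ), ← (φ i).dist_eq,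
    IsometryEquiv.apply_symm_apply, dist_eq_norm, div_eq_inv_mul]

theorem IsometryEquiv.measurePreserving_euclidean (φ : Euc n ≃ᵢ Euc n) :
    MeasurePreserving φ (volume : Measure (Euc n)) volume := by
  let e := φ.toRealAffineIsometryEquiv
  have h1 : ∀ x, φ x = e.linearIsometryEquiv x + φ 0 := by
    intro x
    have := e.map_vadd 0 x
    simpa [e] using this
  have h2 : (φ : Euc n → Euc n) = (fun x => x + φ 0) ∘ e.linearIsometryEquiv := funext h1
  rw [h2]
  exact (measurePreserving_add_right volume (φ 0)).comp e.linearIsometryEquiv.measurePreserving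

/-- Averaging: a function of bounded support whose transported copies sum to at most one bounds the
number of the bodies that meet a large ball, hence the density. -/
theorem packingDensity_le_of_sum_le_one {K : Set (Euc n)} {D : ℝ}
    (hKD : K ⊆ Metric.closedBall 0 D) {g : Euc n → ℝ} (hgm : AEMeasurable g) (hg0 : ∀ x, 0 ≤ g x)
    (hgi : Integrable g) (hgpos : 0 < ∫ x, g x) (hgD : ∀ x, g x ≠ 0 → ‖x‖ ≤ D)
    (hsum : ∀ φ : ℕ → (Euc n ≃ᵢ Euc n), IsPacking K φ →
      ∀ x, ∑' i, ENNReal.ofReal (g ((φ i).symm x)) ≤ 1) :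
    packingDensity K ≤ ENNReal.ofReal (volume.real K / ∫ x, g x) := by
  have hKfin : volume K ≠ ∞ := ((measure_mono hKD).trans_lt measure_closedBall_lt_top).ne
  set G := ∫ x, g x with hG
  refine iSup₂_le fun φ hφ => ?_
  have key : ∀ R : ℝ, 0 ≤ R → volume ((⋃ i, φ i '' K) ∩ Metric.closedBall (0 : Euc n) R) ≤
      ENNReal.ofReal (volume.real K / G) * volume (Metric.closedBall (0 : Euc n) (R + 2 * D)) := by
    intro R hR
    let J : Set ℕ := {i | (φ i '' K ∩ Metric.closedBall (0 : Euc n) R).Nonempty}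
    have h1 : volume ((⋃ i, φ i '' K) ∩ Metric.closedBall (0 : Euc n) R) ≤
        ∑' i : J, volume K := by
      calc volume ((⋃ i, φ i '' K) ∩ Metric.closedBall (0 : Euc n) R)
          ≤ volume (⋃ i : J, φ i '' K) := by
            refine measure_mono ?_
            rintro x ⟨hx, hxR⟩
            obtain ⟨i, hi⟩ := mem_iUnion.1 hx
            exact mem_iUnion.2 ⟨⟨i, ⟨x, hi, hxR⟩⟩, hi⟩
        _ ≤ ∑' i : J, volume (φ i '' K) := measure_iUnion_le _
        _ = ∑' i : J, volume K := by
            refine tsum_congr fun i => ?_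
            have hpre := (φ i).symm.measurePreserving_euclidean.measure_preimage_emb
              (φ i).symm.toHomeomorph.measurableEmbedding K
            rw [← hpre]
            congr 1
            exact (φ i).toEquiv.image_eq_preimage_symm K
    have hsupp : ∀ i : J, ∀ x, ENNReal.ofReal (g ((φ i).symm x)) ≠ 0 →
        x ∈ Metric.closedBall (0 : Euc n) (R + 2 * D) := by
      rintro ⟨i, y, ⟨z, hz, rfl⟩, hzR⟩ x hx
      have h2 : g ((φ i).symm x) ≠ 0 := fun h => hx (by simp [h])
      have h3 := hgD _ h2
      have h4 := hKD hz
      rw [mem_closedBall_zero_iff] at h4 hzR ⊢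
      have h5 : dist x (φ i z) = dist ((φ i).symm x) z := by
        rw [← (φ i).symm.dist_eq, IsometryEquiv.symm_apply_apply]
      have h6 : dist ((φ i).symm x) z ≤ D + D := by
        rw [dist_eq_norm]
        exact (norm_sub_le _ _).trans (add_le_add h3 h4)
      have h7 := norm_sub_norm_le x (φ i z)
      rw [dist_eq_norm] at h5
      linarith
    have h2 : ∑' i : J, ENNReal.ofReal G ≤ volume (Metric.closedBall (0 : Euc n) (R + 2 * D)) := by
      calc ∑' i : J, ENNReal.ofReal G
          = ∑' i : J, ∫⁻ x in Metric.closedBall (0 : Euc n) (R + 2 * D),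
              ENNReal.ofReal (g ((φ i).symm x)) := by
            refine tsum_congr fun i => ?_
            rw [setLIntegral_eq_of_support_subset (fun x hx => hsupp i x hx), hG,
              ofReal_integral_eq_lintegral_ofReal hgi (ae_of_all _ hg0)]
            exact ((φ i).symm.measurePreserving_euclidean.lintegral_comp_emb
              (φ i).symm.toHomeomorph.measurableEmbedding fun x => ENNReal.ofReal (g x)).symm
        _ = ∫⁻ x in Metric.closedBall (0 : Euc n) (R + 2 * D),
              ∑' i : J, ENNReal.ofReal (g ((φ i).symm x)) := by
            rw [lintegral_tsum]
            intro i
            exact ((hgm.comp_quasiMeasurePreserving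
              (φ i).symm.measurePreserving_euclidean.quasiMeasurePreserving)
                  |>.ennreal_ofReal).restrict
        _ ≤ ∫⁻ x in Metric.closedBall (0 : Euc n) (R + 2 * D), 1 := by
            refine lintegral_mono fun x => ?_
            exact (ENNReal.tsum_comp_le_tsum_of_injective Subtype.val_injective
              fun i => ENNReal.ofReal (g ((φ i).symm x))).trans (hsum φ hφ x)
        _ = _ := by simp
    have h3 : volume K = ENNReal.ofReal (volume.real K / G) * ENNReal.ofReal G := by
      rw [← ENNReal.ofReal_mul (div_nonneg measureReal_nonneg hgpos.le),
        div_mul_cancel₀ _ hgpos.ne',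
        measureReal_def, ENNReal.ofReal_toReal hKfin]
    calc _ ≤ _ := h1
      _ = ENNReal.ofReal (volume.real K / G) * ∑' i : J, ENNReal.ofReal G := by
          rw [← ENNReal.tsum_mul_left, ← h3]
      _ ≤ _ := by gcongr
  have hlim : Tendsto (fun R : ℝ => ENNReal.ofReal (volume.real K / G) *
      ENNReal.ofReal ((1 + 2 * D / R) ^ n)) atTop
      (nhds (ENNReal.ofReal (volume.real K / G))) := by
    have h1 : Tendsto (fun R : ℝ => (1 + 2 * D / R) ^ n) atTop (nhds 1) := by
      have := ((tendsto_const_nhds (x := 2 * D)).div_atTop tendsto_id).const_add 1 |>.pow n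
      simpa using this
    have h2 := ENNReal.Tendsto.const_mul (ENNReal.tendsto_ofReal h1)
      (Or.inr (ENNReal.ofReal_ne_top (r := volume.real K / G)))
    simpa using h2
  rw [upperDensity, ← hlim.limsup_eq]
  refine limsup_le_limsup ?_
  filter_upwards [eventually_gt_atTop 0, eventually_ge_atTop (-2 * D)] with R hR hRD
  refine ENNReal.div_le_of_le_mul ((key R hR.le).trans (le_of_eq ?_))
  rw [mul_assoc]
  congr 1
  rw [Measure.addHaar_closedBall _ _ hR.le, Measure.addHaar_closedBall _ _ (by linarith),
    ← mul_assoc, ← ENNReal.ofReal_mul (by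
      have : 0 ≤ 1 + 2 * D / R := by
        rw [← sub_nonneg]
        have : 1 + 2 * D / R = (R + 2 * D) / R := by field_simp
        rw [this]
        simpa using div_nonneg (by linarith) hR.le
      positivity), finrank_euclideanSpace, Fintype.card_fin, ← mul_pow]
  congr 3
  field_simp

end

/-! ### Blichfeldt's improved gauge in high dimension -/

theorem rpow_mul_exp_neg_le_Gamma {x y : ℝ} (hx : 0 < x) (hy : 0 ≤ y) :
    x ^ y * Real.exp (-x) ≤ Real.Gamma (y + 1) := by
  have hi := Real.GammaIntegral_convergent (s := y + 1) (by linarith)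
  rw [Real.Gamma_eq_integral (by linarith), ← integral_exp_neg_Ioi, ← integral_const_mul]
  simp only [add_sub_cancel_right] at hi ⊢
  calc ∫ t in Ioi x, x ^ y * Real.exp (-t) ≤ ∫ t in Ioi x, Real.exp (-t) * t ^ y := by
        refine setIntegral_mono_on ((integrableOn_exp_neg_Ioi x).const_mul _)
          (hi.mono_set (Ioi_subset_Ioi hx.le)) measurableSet_Ioi fun t ht => ?_
        rw [mul_comm]
        exact mul_le_mul_of_nonneg_left (Real.rpow_le_rpow hx.le (le_of_lt ht) hy)
          (Real.exp_pos _).le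
    _ ≤ ∫ t in Ioi 0, Real.exp (-t) * t ^ y := by
        refine setIntegral_mono_set hi ?_ (Ioi_subset_Ioi hx.le).eventuallyLE
        filter_upwards [ae_restrict_mem measurableSet_Ioi] with t ht
        exact mul_nonneg (Real.exp_pos _).le (Real.rpow_nonneg (le_of_lt ht) _)

theorem volume_unitBall {n : ℕ} (hn : 0 < n) :
    volume.real (unitBall n) = Real.sqrt Real.pi ^ n / Real.Gamma (n / 2 + 1) := by
  have : Nonempty (Fin n) := ⟨⟨0, hn⟩⟩
  have hG : 0 < Real.Gamma ((n : ℝ) / 2 + 1) := Real.Gamma_pos_of_pos (by positivity)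
  rw [unitBall, measureReal_def, EuclideanSpace.volume_closedBall]
  simp only [ENNReal.ofReal_one, one_pow, one_mul, Fintype.card_fin]
  rw [ENNReal.toReal_ofReal (by positivity)]

/-- In high dimension the insphere, enlarged by the factor `√1.8`, has more than ten times the
volume of `X^n`, because `0.9 π > e`. -/
theorem exists_volume_crossPolytope_lt :
    ∃ N : ℕ, 2 ≤ N ∧ ∀ n, N ≤ n → volume.real (l1Ball n 1) <
      crossInradius n ^ n * (1 / 10 * (Real.sqrt 1.8 ^ n * volume.real (unitBall n))) := by
  set q := Real.sqrt (0.9 * Real.pi / Real.exp 1) with hq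
  have hq1 : 1 < q := by
    rw [hq, Real.lt_sqrt (by norm_num), one_pow, one_lt_div (Real.exp_pos 1)]
    linarith [Real.pi_gt_d2, Real.exp_one_lt_d9]
  have hlim := tendsto_pow_const_div_const_pow_of_one_lt 1 hq1
  have hpi : 0 < Real.sqrt Real.pi := Real.sqrt_pos.2 Real.pi_pos
  obtain ⟨N, hN⟩ := eventually_atTop.1 (hlim.eventually_lt_const
    (show (0 : ℝ) < 1 / (10 * Real.sqrt Real.pi) by positivity))
  refine ⟨max N 2, le_max_right _ _, fun n hn => ?_⟩
  have hn2 : 2 ≤ n := (le_max_right _ _).trans hn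
  have hn2' : (2 : ℝ) ≤ n := by exact_mod_cast hn2
  have hn0 : (0 : ℝ) < n := by linarith
  have hbig : 10 * Real.sqrt Real.pi * n < q ^ n := by
    have h := hN n ((le_max_left _ _).trans hn)
    rw [pow_one, div_lt_div_iff₀ (by positivity) (by positivity), one_mul] at h
    linarith
  have hG1 : 0 < Real.Gamma ((n : ℝ) / 2 + 1) := Real.Gamma_pos_of_pos (by positivity)
  have hfac : (0 : ℝ) < n.factorial := by exact_mod_cast n.factorial_pos
  -- Legendre's duplication formula replaces `n! / Γ(n / 2 + 1)` by one Gamma value.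
  have hdup : Real.Gamma (((n : ℝ) + 1) / 2) * Real.Gamma ((n : ℝ) / 2 + 1)
      = n.factorial * (2 ^ n)⁻¹ * Real.sqrt Real.pi := by
    have h := Real.Gamma_mul_Gamma_add_half (((n : ℝ) + 1) / 2)
    rw [show ((n : ℝ) + 1) / 2 + 1 / 2 = (n : ℝ) / 2 + 1 by ring,
      show 2 * (((n : ℝ) + 1) / 2) = (n : ℝ) + 1 by ring, Real.Gamma_nat_eq_factorial,
      show 1 - ((n : ℝ) + 1) = -(n : ℝ) by ring, Real.rpow_neg two_pos.le, Real.rpow_natCast] at h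
    exact h
  have hGlow : Real.sqrt (n / 2) ^ n * Real.exp (-(n / 2)) ≤
      n * Real.Gamma (((n : ℝ) + 1) / 2) := by
    have h1 := rpow_mul_exp_neg_le_Gamma (x := (n : ℝ) / 2) (y := ((n : ℝ) + 1) / 2)
      (by positivity) (by positivity)
    rw [Real.Gamma_add_one (by positivity)] at h1
    have h2 : Real.sqrt (n / 2) ^ n ≤ ((n : ℝ) / 2) ^ (((n : ℝ) + 1) / 2) := by
      rw [Real.sqrt_eq_rpow, ← Real.rpow_natCast, ← Real.rpow_mul (by positivity)]
      exact Real.rpow_le_rpow_of_exponent_le (by linarith) (by linarith)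
    have h3 : 0 ≤ Real.Gamma (((n : ℝ) + 1) / 2) := (Real.Gamma_pos_of_pos (by positivity)).le
    calc _ ≤ ((n : ℝ) / 2) ^ (((n : ℝ) + 1) / 2) * Real.exp (-(n / 2)) := by gcongr
      _ ≤ _ := h1
      _ ≤ n * Real.Gamma (((n : ℝ) + 1) / 2) := by
          gcongr
          linarith
  have hexp : Real.exp (-((n : ℝ) / 2)) = Real.sqrt (Real.exp (-1)) ^ n := by
    rw [← Real.exp_half, ← Real.exp_nat_mul]
    congr 1
    ring
  have hqn : q ^ n * Real.sqrt n ^ n = Real.sqrt 1.8 ^ n * Real.sqrt Real.pi ^ n *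
      (Real.sqrt (n / 2) ^ n * Real.sqrt (Real.exp (-1)) ^ n) := by
    rw [hq, ← mul_pow, ← mul_pow, ← mul_pow, ← mul_pow, ← Real.sqrt_mul (by positivity),
      ← Real.sqrt_mul (by norm_num), ← Real.sqrt_mul (by positivity),
      ← Real.sqrt_mul (by positivity), Real.exp_neg]
    congr 2
    field_simp
    norm_num
  refine (volume_l1Ball_one_le (by omega)).trans_lt ?_
  rw [volume_unitBall (by omega), crossInradius, div_pow, one_pow]
  have hsn : 0 < Real.sqrt n ^ n := pow_pos (Real.sqrt_pos.2 hn0) n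
  have hA : (2 : ℝ) ^ n / n.factorial = Real.sqrt Real.pi /
      (Real.Gamma (((n : ℝ) + 1) / 2) * Real.Gamma ((n : ℝ) / 2 + 1)) := by
    rw [hdup]
    field_simp
  rw [hA]
  have hG2 : 0 < Real.Gamma (((n : ℝ) + 1) / 2) := Real.Gamma_pos_of_pos (by positivity)
  set Γ₁ := Real.Gamma (((n : ℝ) + 1) / 2)
  set Γ₂ := Real.Gamma ((n : ℝ) / 2 + 1)
  have hmain : 10 * Real.sqrt Real.pi * Real.sqrt n ^ n <
      Real.sqrt 1.8 ^ n * Real.sqrt Real.pi ^ n * Γ₁ := by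
    refine lt_of_mul_lt_mul_left ?_ hn0.le
    calc n * (10 * Real.sqrt Real.pi * Real.sqrt n ^ n)
        = 10 * Real.sqrt Real.pi * n * Real.sqrt n ^ n := by ring
      _ < q ^ n * Real.sqrt n ^ n := mul_lt_mul_of_pos_right hbig hsn
      _ = Real.sqrt 1.8 ^ n * Real.sqrt Real.pi ^ n *
            (Real.sqrt (n / 2) ^ n * Real.exp (-(n / 2))) := by rw [hqn, hexp]
      _ ≤ Real.sqrt 1.8 ^ n * Real.sqrt Real.pi ^ n * (n * Γ₁) := by gcongr
      _ = _ := by ring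
  rw [show 1 / Real.sqrt n ^ n * (1 / 10 * (Real.sqrt 1.8 ^ n * (Real.sqrt Real.pi ^ n / Γ₂)))
    = (Real.sqrt 1.8 ^ n * Real.sqrt Real.pi ^ n) / (10 * Real.sqrt n ^ n * Γ₂) by field_simp,
    div_lt_div_iff₀ (by positivity) (by positivity)]
  have := mul_lt_mul_of_pos_right hmain hG1
  linarith

theorem measurable_blichfeldtZero : Measurable blichfeldtZero :=
  Measurable.ite measurableSet_Iic (by fun_prop) measurable_const

theorem measurable_blichfeldtStar : Measurable blichfeldtStar :=
  Measurable.ite measurableSet_Ici measurable_blichfeldtZero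
    (measurable_const.sub (measurable_blichfeldtZero.comp (by fun_prop)))

theorem blichfeldtZero_mem_Icc {r : ℝ} (hr : 1 ≤ r) : blichfeldtZero r ∈ Icc (0 : ℝ) (1 / 2) := by
  unfold blichfeldtZero
  split_ifs with h
  · have := (Real.le_sqrt' (by linarith)).1 h
    constructor <;> nlinarith
  · norm_num

theorem blichfeldtStar_nonneg (r : ℝ) : 0 ≤ blichfeldtStar r := by
  unfold blichfeldtStar
  split_ifs with h
  · exact (blichfeldtZero_mem_Icc h).1
  · linarith [(blichfeldtZero_mem_Icc (r := 2 - r) (by linarith)).2]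

theorem blichfeldtStar_le_one (r : ℝ) : blichfeldtStar r ≤ 1 := by
  unfold blichfeldtStar
  split_ifs with h
  · linarith [(blichfeldtZero_mem_Icc h).2]
  · linarith [(blichfeldtZero_mem_Icc (r := 2 - r) (by linarith)).1]

theorem blichfeldtStar_eq_zero {r : ℝ} (hr : Real.sqrt 2 < r) : blichfeldtStar r = 0 := by
  have h1 : 1 ≤ Real.sqrt 2 := Real.one_le_sqrt.2 (by norm_num)
  rw [blichfeldtStar, if_pos (by linarith), blichfeldtZero, if_neg (not_le.2 hr)]

theorem blichfeldtStar_zero : blichfeldtStar 0 = 1 := by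
  have h : ¬ (2 : ℝ) - 0 ≤ Real.sqrt 2 := by
    rw [sub_zero, not_le, Real.sqrt_lt' two_pos]
    norm_num
  rw [blichfeldtStar, if_neg (by norm_num), blichfeldtZero, if_neg h, sub_zero]

theorem one_tenth_le_blichfeldtStar {r : ℝ} (hr : r ≤ Real.sqrt 1.8) :
    1 / 10 ≤ blichfeldtStar r := by
  unfold blichfeldtStar
  split_ifs with h
  · have h1 : r ^ 2 ≤ 1.8 := (Real.le_sqrt' (by linarith)).1 hr
    have h2 : r ≤ Real.sqrt 2 := hr.trans (Real.sqrt_le_sqrt (by norm_num))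
    rw [blichfeldtZero, if_pos h2]
    linarith
  · linarith [(blichfeldtZero_mem_Icc (r := 2 - r) (by linarith)).2]

theorem radialIntegral_blichfeldtStar_ge (n : ℕ) :
    1 / 10 * (Real.sqrt 1.8 ^ n * volume.real (unitBall n)) ≤ radialIntegral n blichfeldtStar := by
  have hi := integrableOn_mul_pow_of_bounded measurable_blichfeldtStar.aemeasurable
    (fun s _ => blichfeldtStar_nonneg s) (fun s _ => blichfeldtStar_le_one s)
    (fun s => blichfeldtStar_eq_zero)
  have hint : Integrable fun x : Euc n => blichfeldtStar ‖x‖ := by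
    have h := (integral_infDist_l1Ball (n := n) measurable_blichfeldtStar.aemeasurable
      (fun m _ => hi m) le_rfl).1
    simpa [l1Ball_zero] using h
  rw [← volume_closedBall_eq (Real.sqrt_nonneg _), mul_comm, ← smul_eq_mul, ← setIntegral_const]
  calc ∫ _ in Metric.closedBall (0 : Euc n) (Real.sqrt 1.8), (1 / 10 : ℝ)
      ≤ ∫ x in Metric.closedBall (0 : Euc n) (Real.sqrt 1.8), blichfeldtStar ‖x‖ := by
        refine setIntegral_mono_on (integrableOn_const measure_closedBall_lt_top.ne)
          hint.integrableOn measurableSet_closedBall fun x hx => ?_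
        exact one_tenth_le_blichfeldtStar (mem_closedBall_zero_iff.1 hx)
    _ ≤ ∫ x : Euc n, blichfeldtStar ‖x‖ :=
        setIntegral_le_integral hint (ae_of_all _ fun x => blichfeldtStar_nonneg _)

theorem Polynomial.exists_lt_eval_of_derivative_neg {p : Polynomial ℝ} {r : ℝ} (hr : 0 < r)
    (hp : p.derivative.eval r < 0) : ∃ t ∈ Ioo 0 r, p.eval r < p.eval t := by
  have h1 := (p.hasDerivAt r).tendsto_slope.mono_left
    (nhdsWithin_mono r (s := Iio r) fun x hx => (ne_of_lt hx : x ≠ r))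
  obtain ⟨t, ht, ht0⟩ := ((h1.eventually_lt_const hp).and (Ioo_mem_nhdsLT hr)).exists
  refine ⟨t, ht0, ?_⟩
  rw [slope_def_field, div_neg_iff] at ht
  rcases ht with ht | ht
  · linarith
  · linarith [ht0.2]

theorem exists_isMinOn_div_eval {p : Polynomial ℝ} {v r : ℝ} (hv : 0 < v) (hr : 0 < r)
    (hpos : ∀ t ∈ Icc 0 r, 0 < p.eval t) (hder : p.derivative.eval r < 0)
    (hends : p.eval 0 < p.eval r) :
    (∃ t ∈ Ioo 0 r, IsMinOn (fun t => v / p.eval t) (Icc 0 r) t) ∧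
      ∀ t ∈ Icc 0 r, IsMinOn (fun t => v / p.eval t) (Icc 0 r) t → t ∈ Ioo 0 r := by
  have hint : ∀ t ∈ Icc 0 r, IsMinOn (fun t => v / p.eval t) (Icc 0 r) t → t ∈ Ioo 0 r := by
    intro t ht hmin
    refine ⟨lt_of_le_of_ne ht.1 ?_, lt_of_le_of_ne ht.2 ?_⟩
    · rintro rfl
      have h := isMinOn_iff.1 hmin r (right_mem_Icc.2 hr.le)
      exact absurd h (not_le.2 (div_lt_div_of_pos_left hv (hpos 0 ht) hends))
    · rintro rfl
      obtain ⟨u, hu, hlt⟩ := Polynomial.exists_lt_eval_of_derivative_neg hr hder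
      have h := isMinOn_iff.1 hmin u (Ioo_subset_Icc_self hu)
      exact absurd h (not_le.2 (div_lt_div_of_pos_left hv (hpos t ht) hlt))
  obtain ⟨t, ht, hmin⟩ := isCompact_Icc.exists_isMinOn (nonempty_Icc.2 hr.le)
    (f := fun t => v / p.eval t)
    (continuousOn_const.div p.continuous.continuousOn fun t ht => (hpos t ht).ne')
  exact ⟨⟨t, hint t ht hmin, hmin⟩, hint⟩

/-! ### The density bound and its minimum -/

theorem mainTheorem3 :
    (∀ r₀ : ℝ, 0 < r₀ → ∃ N : ℕ, ∀ n : ℕ, N ≤ n → ∀ f : ℝ → ℝ,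
      IsBlichfeldtGauge (unitBall n) f → (∀ r : ℝ, r₀ < r → f r = 0) → radialIntegral n f ≠ 0 →
        -- `G` is well defined and positive on `(0, r_n]`
        (∀ ϱ ∈ Set.Ioc 0 (crossInradius n),
          MeasureTheory.Integrable (transferredGauge (crossPolytope n) f ϱ) ∧ 0 < crossG n f ϱ) ∧
        -- `G` is a polynomial and `G'(r_n) < 0`
        (∃ p : Polynomial ℝ, ExtendsCrossG n f p ∧
          p.derivative.eval (crossInradius n) < 0) ∧
        -- `vol(X^n) / G(ϱ)` is an upper bound for the packing density of `X^n`
        (∀ ϱ ∈ Set.Ioc 0 (crossInradius n),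
          packingDensity (crossPolytope n) ≤
            ENNReal.ofReal (MeasureTheory.volume.real (crossPolytope n) / crossG n f ϱ)) ∧
        -- for some `ϱ` it is strictly better than the insphere bound with the same gauge
        (∃ ϱ ∈ Set.Ioo 0 (crossInradius n),
          MeasureTheory.volume.real (crossPolytope n) / crossG n f ϱ <
            MeasureTheory.volume.real (crossPolytope n) /
                (crossInradius n ^ n * MeasureTheory.volume.real (unitBall n)) *
              (MeasureTheory.volume.real (unitBall n) / radialIntegral n f))) ∧
    (∃ N : ℕ, ∀ n : ℕ, N ≤ n → ∃ p : Polynomial ℝ, ExtendsCrossG n blichfeldtStar p ∧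
      p.derivative.eval (crossInradius n) < 0 ∧
      (∀ ϱ ∈ Set.Icc 0 (crossInradius n), 0 < p.eval ϱ) ∧
      -- the minimum over `[0, r_n]` is attained, and only at interior points
      (∃ ϱ ∈ Set.Ioo 0 (crossInradius n),
        IsMinOn (fun t : ℝ => MeasureTheory.volume.real (crossPolytope n) / p.eval t)
          (Set.Icc 0 (crossInradius n)) ϱ) ∧
      (∀ ϱ ∈ Set.Icc 0 (crossInradius n),
        IsMinOn (fun t : ℝ => MeasureTheory.volume.real (crossPolytope n) / p.eval t)
          (Set.Icc 0 (crossInradius n)) ϱ → ϱ ∈ Set.Ioo 0 (crossInradius n))) := by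
  refine ⟨fun r₀ _ => ?_, ?_⟩
  · obtain ⟨N, hN3, hN⟩ := exists_derivative_crossPoly_neg r₀
    refine ⟨N, fun n hn f hf hr hI => ?_⟩
    have hn0 : 0 < n := by omega
    have hf1 : ∀ s, 0 ≤ s → f s ≤ 1 := fun s hs => hf.le_one hn0 hs
    have hi := integrableOn_mul_pow_of_bounded hf.measurable hf.nonneg hf1 hr
    have hIpos : 0 < radialIntegral n f :=
      lt_of_le_of_ne (integral_nonneg fun x => hf.nonneg _ (norm_nonneg x)) hI.symm
    have hext := extendsCrossG_crossPoly hn0 hf.measurable fun m _ => hi m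
    have hder := hN n hn f hf.measurable hf.nonneg hf1 hr hIpos
    have hvol : 0 < volume.real (crossPolytope n) := by
      rw [crossPolytope_eq_l1Ball hn0]
      exact volume_l1Ball_one_pos n
    have hrn := crossInradius_pos hn0
    have hpos : ∀ ϱ ∈ Ioc 0 (crossInradius n), 0 < crossG n f ϱ := fun ϱ hϱ => by
      rw [← hext ϱ hϱ]
      exact (mul_pos (pow_pos hϱ.1 n) hIpos).trans_le
        (pow_mul_radialIntegral_le_eval_crossPoly hn0 hf.measurable (fun m _ => hi m) hf.nonneg
          ⟨hϱ.1.le, hϱ.2⟩)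
    have hint : ∀ ϱ ∈ Ioc 0 (crossInradius n),
        Integrable (transferredGauge (crossPolytope n) f ϱ) := fun ϱ hϱ =>
      integrable_transferredGauge hn0 hf.measurable (fun m _ => hi m) hϱ
    refine ⟨fun ϱ hϱ => ⟨hint ϱ hϱ, hpos ϱ hϱ⟩, ⟨crossPoly n f, hext, hder⟩, fun ϱ hϱ => ?_, ?_⟩
    · have hlam := one_sub_sqrt_mul_nonneg hn0 hϱ.2
      have hpar := innerParallel_crossPolytope hn0 hϱ.1.le
      have hlam1 : 1 - Real.sqrt n * ϱ ≤ 1 := by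
        linarith [mul_nonneg (Real.sqrt_nonneg n) hϱ.1.le]
      refine packingDensity_le_of_sum_le_one (D := 1 + |r₀| * ϱ) ?_
        (hint ϱ hϱ).aestronglyMeasurable.aemeasurable
        (fun x => hf.nonneg _ (div_nonneg Metric.infDist_nonneg hϱ.1.le)) (hint ϱ hϱ) (hpos ϱ hϱ)
        (fun x hx => ?_) fun φ hφ x => ?_
      · rw [crossPolytope_eq_l1Ball hn0]
        exact (l1Ball_subset_closedBall n 1).trans (Metric.closedBall_subset_closedBall
          (le_add_of_nonneg_right (mul_nonneg (abs_nonneg _) hϱ.1.le)))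
      · have h1 : Metric.infDist x (innerParallel (crossPolytope n) ϱ) / ϱ ≤ r₀ :=
          not_lt.1 fun h => hx (hr _ h)
        rw [div_le_iff₀ hϱ.1, hpar] at h1
        have h2 := infDist_le_subset hlam (r₀ * ϱ) h1
        rw [mem_closedBall_zero_iff] at h2
        have h3 := mul_le_mul_of_nonneg_right (le_abs_self r₀) hϱ.1.le
        linarith
      · refine sum_transferredGauge_le_one hf hϱ.1 ?_ ?_ hφ x
        · rw [hpar]
          exact isCompact_l1Ball n _
        · rw [hpar]
          exact nonempty_l1Ball hlam
    · obtain ⟨ϱ, hϱ, hlt⟩ := Polynomial.exists_lt_eval_of_derivative_neg hrn hder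
      refine ⟨ϱ, hϱ, ?_⟩
      rw [hext ϱ (Ioo_subset_Ioc_self hϱ),
        eval_crossPoly_crossInradius hn0 hf.measurable fun m _ => hi m] at hlt
      have hball : volume.real (unitBall n) ≠ 0 :=
        (ENNReal.toReal_pos (Metric.measure_closedBall_pos _ _ one_pos).ne'
          measure_closedBall_lt_top.ne).ne'
      have hrhs : volume.real (crossPolytope n) /
            (crossInradius n ^ n * volume.real (unitBall n)) *
              (volume.real (unitBall n) / radialIntegral n f)
          = volume.real (crossPolytope n) / (crossInradius n ^ n * radialIntegral n f) := by
        field_simp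
      rw [hrhs]
      exact div_lt_div_of_pos_left hvol (mul_pos (pow_pos hrn n) hIpos) hlt
  · obtain ⟨N₁, hN3, hN₁⟩ := exists_derivative_crossPoly_neg (Real.sqrt 2)
    obtain ⟨N₂, -, hN₂⟩ := exists_volume_crossPolytope_lt
    refine ⟨max N₁ N₂, fun n hn => ?_⟩
    have hn1 : N₁ ≤ n := (le_max_left _ _).trans hn
    have hn0 : 0 < n := by omega
    have hm := measurable_blichfeldtStar.aemeasurable (μ := volume.restrict (Ici (0 : ℝ)))
    have hf0 : ∀ s : ℝ, 0 ≤ s → 0 ≤ blichfeldtStar s := fun s _ => blichfeldtStar_nonneg s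
    have hi := integrableOn_mul_pow_of_bounded hm hf0 (fun s _ => blichfeldtStar_le_one s)
      fun s => blichfeldtStar_eq_zero
    have hrn := crossInradius_pos hn0
    have hends : (crossPoly n blichfeldtStar).eval 0
        < (crossPoly n blichfeldtStar).eval (crossInradius n) := by
      rw [eval_zero_crossPoly, blichfeldtStar_zero, mul_one,
        eval_crossPoly_crossInradius hn0 hm fun m _ => hi m]
      exact (hN₂ n ((le_max_right _ _).trans hn)).trans_le
        (mul_le_mul_of_nonneg_left (radialIntegral_blichfeldtStar_ge n) (pow_nonneg hrn.le n))
    have hp0 : 0 < (crossPoly n blichfeldtStar).eval 0 := by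
      rw [eval_zero_crossPoly, blichfeldtStar_zero, mul_one]
      exact volume_l1Ball_one_pos n
    have hIpos : 0 < radialIntegral n blichfeldtStar := by
      have h := hp0.trans hends
      rw [eval_crossPoly_crossInradius hn0 hm fun m _ => hi m] at h
      exact pos_of_mul_pos_right h (pow_nonneg hrn.le n)
    have hder := hN₁ n hn1 blichfeldtStar hm hf0 (fun s _ => blichfeldtStar_le_one s)
      (fun s => blichfeldtStar_eq_zero) hIpos
    have hpos : ∀ ϱ ∈ Icc 0 (crossInradius n), 0 < (crossPoly n blichfeldtStar).eval ϱ := by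
      intro ϱ hϱ
      rcases hϱ.1.eq_or_lt with rfl | h
      · exact hp0
      · exact (mul_pos (pow_pos h n) hIpos).trans_le
          (pow_mul_radialIntegral_le_eval_crossPoly hn0 hm (fun m _ => hi m) hf0 hϱ)
    have hvol : 0 < volume.real (crossPolytope n) := by
      rw [crossPolytope_eq_l1Ball hn0]
      exact volume_l1Ball_one_pos n
    obtain ⟨h1, h2⟩ := exists_isMinOn_div_eval hvol hrn hpos hder hends
    exact ⟨crossPoly n blichfeldtStar, extendsCrossG_crossPoly hn0 hm fun m _ => hi m, hder, hpos,
      h1, h2⟩
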